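/- Let $T>0$, let $\Omega\subset\mathbb{R}^3$ be a bounded Lipschitz domain (a bounded open set, not necessarily connected, which near each boundary point is, in suitable Cartesian coordinates, the region strictly below the graph of a Lipschitz function), let $\nu$ be its outward unit normal and let $\int_{\partial\Omega}$ denote the integral with respect to surface area. Let $u(t,x)\in\mathbb{R}^3$ and $\rho(t,x)\in\mathbb{R}$ be given, with $\rho\neq0$ on $(0,T)\times\overline\Omega$, and let $B(t,x)\in\mathbb{R}^3$. Suppose that these functions are sufficiently smooth up to the boundary, in the following sense: they are defined on $\mathbb{R}\times\mathbb{R}^3$, $B$ is $C^1$ in $(t,x)$ near each point of $(0,T)\times\overline\Omega$, and for each $t\in(0,T)$ the function $B(t,\cdot)$ is $C^2$, and $u(t,\cdot)$ and $\rho(t,\cdot)$ are $C^1$, near each point of $\overline\Omega$. Put $$ R := (B\cdot\nabla)u-\tfrac12\bigl(B\,(\operatorname{div}u)+(u\cdot\nabla)B+\operatorname{div}(B\otimes u)\bigr)-\nabla\times\Bigl(\frac{\nabla\times B}{\rho}\times B\Bigr),\qquad \operatorname{div}(B\otimes u)_i=\sum_j\partial_j(B_iu_j), $$ and, on $\partial\Omega$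 wherever $\nu$ exists (hence almost everywhere with respect to surface area), $$ \psi := \mathbf 1_{\left(\frac u2-\frac{\nabla\times B}{\rho}\right)\cdot\nu<0}\Bigl(\Bigl(\frac u2-\frac{\nabla\times B}{\rho}\Bigr)\cdot\nu\Bigr)B+(B\cdot\nu)\,\frac{\nabla\times B}{\rho}. $$ Suppose that $B$ solves the split form of the magnetic induction equation with Hall effect and outflow boundary condition, in one of the following two senses. (a) Strong implementation: for every $t\in(0,T)$, $\partial_tB=R$ in $\Omega$, and $\psi=0$ at every point of $\partial\Omega$ at which $\nu$ exists. (b) Weak implementation: $\partial_tB=R+L(\psi)$ for every $t\in(0,T)$, where the lifting operator $L$ assigns to $\psi$ the functional $\varphi\mapsto\int_{\partial\Omega}\varphi\cdot\psi$ on smooth test fields; that is, for every $t\in(0,T)$ and every $\varphi\in C^\infty(\mathbb{R}^3;\mathbb{R}^3)$, $$\int_\Omega\varphi\cdot\partial_tB=\int_\Omega\varphi\cdot R+\int_{\partial\Omega}\varphi\cdot\psi .$$ Then, for every $t\in(0,T)$, the function $s\mapsto\|B(s)\|_{L^2(\Omega)}^2=\int_\Omega|B(s,x)|^2\,dx$ is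 differentiable at $t$ and $$\frac{d}{dt}\|B(t)\|_{L^2(\Omega)}^2=2\int_\Omega B\cdot\partial_tB\le 9\,\|\nabla u(t)\|_{L^\infty(\Omega)}\,\|B(t)\|_{L^2(\Omega)}^2,$$ where $\|\nabla u(t)\|_{L^\infty(\Omega)}=\max_{i,j}\|\partial_ju_i(t)\|_{L^\infty(\Omega)}$. -/

import Mathlib

open MeasureTheory Set Topology
open scoped ContDiff NNReal RealInnerProductSpace Matrix

noncomputable section

namespace HallInduction

/-- Physical space `ℝ³` with the Euclidean norm. -/
abbrev E3 : Type := EuclideanSpace ℝ (Fin 3)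

/-! ### Vector calculus in `ℝ³` -/

/-- The `j`-th partial derivative of a scalar field. -/
def pd (j : Fin 3) (f : E3 → ℝ) (x : E3) : ℝ :=
  fderiv ℝ f x (EuclideanSpace.single j 1)

/-- The cross product of `ℝ³`. -/
def cross (a b : E3) : E3 := WithLp.toLp 2 (a.ofLp ⨯₃ b.ofLp)

/-- The divergence `∂ⱼ Fⱼ`. -/
def divg (F : E3 → E3) (x : E3) : ℝ := ∑ j, pd j (fun y => F y j) x

/-- The curl `∇ × F`. -/
def curl (F : E3 → E3) (x : E3) : E3 :=
  !₂[pd 1 (fun y => F y 2) x - pd 2 (fun y => F y 1) x,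
     pd 2 (fun y => F y 0) x - pd 0 (fun y => F y 2) x,
     pd 0 (fun y => F y 1) x - pd 1 (fun y => F y 0) x]

/-- The directional derivative `(a · ∇) F`, with components `aⱼ ∂ⱼ Fᵢ`. -/
def advect (a F : E3 → E3) (x : E3) : E3 :=
  WithLp.toLp 2 (fun i => ∑ j, a x j * pd j (fun y => F y i) x)

/-- `div (F ⊗ a)`, with components `∂ⱼ (Fᵢ aⱼ)`. -/
def divTensor (F a : E3 → E3) (x : E3) : E3 :=
  WithLp.toLp 2 (fun i => ∑ j, pd j (fun y => F y i * a y j) x)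

/-! ### Bounded Lipschitz domains, outward normal, surface measure -/

/-- A bounded Lipschitz domain of `ℝ³`: a bounded open set which, near each of its boundary points
and in suitable Cartesian coordinates (first two coordinates: a plane; third coordinate: a line), is
the region strictly below the graph of a Lipschitz function. -/
structure IsBoundedLipschitzDomain (Ω : Set E3) : Prop where
  isOpen : IsOpen Ω
  isBounded : Bornology.IsBounded Ω
  locally_subgraph : ∀ x ∈ frontier Ω, ∃ U ∈ 𝓝 x,
    ∃ e : E3 ≃ₗᵢ[ℝ] WithLp 2 (EuclideanSpace ℝ (Fin 2) × ℝ),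
    ∃ (K : ℝ≥0) (g : EuclideanSpace ℝ (Fin 2) → ℝ), LipschitzWith K g ∧
      ∀ y ∈ U, y ∈ Ω ↔ (e y).snd < g (e y).fst

/-- `n` is the outward unit normal of `Ω` at `x`: up to `o(|y - x|)`, the points `y` of `Ω` near `x`
lie in the half space `(y - x) · n ≤ 0` and the other points near `x` in the opposite one. -/
def IsOutwardUnitNormal (Ω : Set E3) (x n : E3) : Prop :=
  ‖n‖ = 1 ∧ ∀ ε : ℝ, 0 < ε → ∀ᶠ y in 𝓝 x,
    (y ∈ Ω → ⟪y - x, n⟫ ≤ ε * ‖y - x‖) ∧ (y ∉ Ω → -(ε * ‖y - x‖) ≤ ⟪y - x, n⟫)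

/-- There is at most one outward unit normal at a point. -/
theorem IsOutwardUnitNormal.unique {Ω : Set E3} {x n m : E3}
    (hn : IsOutwardUnitNormal Ω x n) (hm : IsOutwardUnitNormal Ω x m) : n = m := by
  by_contra hne
  set c : ℝ := ⟪n, m⟫ with hc
  have hnn : ⟪n, n⟫ = 1 := by rw [real_inner_self_eq_norm_sq, hn.1]; norm_num
  have hmm : ⟪m, m⟫ = 1 := by rw [real_inner_self_eq_norm_sq, hm.1]; norm_num
  have hv : 0 < ‖m - n‖ := norm_pos_iff.2 (sub_ne_zero.2 (Ne.symm hne))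
  have hsq : ‖m - n‖ ^ 2 = 2 * (1 - c) := by
    rw [← real_inner_self_eq_norm_sq, inner_sub_left, inner_sub_right, inner_sub_right, hnn, hmm,
      real_inner_comm n m, ← hc]; ring
  have hcpos : 0 < 1 - c := by nlinarith
  have hε : 0 < (1 - c) / (2 * ‖m - n‖) := by positivity
  have hlim : Filter.Tendsto (fun t : ℝ => x + t • (m - n)) (𝓝[>] 0) (𝓝 x) := by
    have h : Continuous (fun t : ℝ => x + t • (m - n)) := by fun_prop
    have h2 := h.tendsto 0
    simp only [zero_smul, add_zero] at h2
    exact h2.mono_left nhdsWithin_le_nhds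
  have key := hlim.eventually ((hn.2 _ hε).and (hm.2 _ hε))
  obtain ⟨t, ⟨hA, hB⟩, ht⟩ := (key.and self_mem_nhdsWithin).exists
  have ht0 : (0 : ℝ) < t := ht
  have hnorm : (1 - c) / (2 * ‖m - n‖) * ‖x + t • (m - n) - x‖ = t * (1 - c) / 2 := by
    rw [add_sub_cancel_left, norm_smul, Real.norm_of_nonneg ht0.le]
    field_simp
  have hin : ⟪x + t • (m - n) - x, n⟫ = -(t * (1 - c)) := by
    rw [add_sub_cancel_left, real_inner_smul_left, inner_sub_left, hnn, real_inner_comm n m, ← hc]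
    ring
  have him : ⟪x + t • (m - n) - x, m⟫ = t * (1 - c) := by
    rw [add_sub_cancel_left, real_inner_smul_left, inner_sub_left, hmm, ← hc]
  have hp : 0 < t * (1 - c) := mul_pos ht0 hcpos
  by_cases hy : x + t • (m - n) ∈ Ω
  · have h := hB.1 hy
    rw [hnorm, him] at h
    linarith
  · have h := hA.2 hy
    rw [hnorm, hin] at h
    linarith

open Classical in
/-- The outward unit normal `ν` at `x`, with the value `0` where there is none (which, for a
Lipschitz domain, concerns only a set of boundary points of surface measure zero). -/
def outwardNormal (Ω : Set E3) (x : E3) : E3 :=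
  if h : ∃ n, IsOutwardUnitNormal Ω x n then h.choose else 0

/-- The surface integral over `∂Ω`. The surface measure is the two-dimensional Hausdorff measure,
normalised so that it is the usual area on planes. -/
def surfaceIntegral (Ω : Set E3) (f : E3 → ℝ) : ℝ := ∫ x in frontier Ω, f x ∂μHE[2]

/-- The lifting operator: `L(ψ)` is the linear functional on test fields given by
`φ ↦ ∫_{∂Ω} φ · ψ`, that is, `ψ` times the surface measure of `∂Ω`. -/
def lifting (Ω : Set E3) (ψ φ : E3 → E3) : ℝ := surfaceIntegral Ω (fun x => ⟪φ x, ψ x⟫)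

/-! ### Norms -/

/-- `‖F‖²` in `L²(Ω)`. -/
def l2NormSq (Ω : Set E3) (F : E3 → E3) : ℝ := ∫ x in Ω, ‖F x‖ ^ 2

/-- `‖∇ v‖` in `L^∞(Ω)`, the maximum over `i, j` of the essential suprema of `|∂ⱼ vᵢ|` on `Ω`. -/
def gradSupNorm (Ω : Set E3) (v : E3 → E3) : ℝ :=
  ⨆ p : Fin 3 × Fin 3,
    (eLpNorm (fun x => pd p.2 (fun y => v y p.1) x) ⊤ (volume.restrict Ω)).toReal

/-! ### The Hall induction equation and the outflow condition -/

/-- `(∇ × B) / ρ`. -/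
def current (ρ : E3 → ℝ) (B : E3 → E3) (x : E3) : E3 := (ρ x)⁻¹ • curl B x

/-- The right hand side of the split form of the induction equation with Hall term,
`(B · ∇) u - (B div u + (u · ∇) B + div (B ⊗ u)) / 2 - ∇ × ((∇ × B) / ρ × B)`. -/
def splitRHS (u : E3 → E3) (ρ : E3 → ℝ) (B : E3 → E3) (x : E3) : E3 :=
  advect B u x
    - (1 / 2 : ℝ) • (divg u x • B x + advect u B x + divTensor B u x)
    - curl (fun y => cross (current ρ B y) (B y)) x

open Classical in
/-- The boundary expression
`1_{(u/2 - (∇ × B)/ρ) · ν < 0} ((u/2 - (∇ × B)/ρ) · ν) B + (B · ν) (∇ × B)/ρ`. -/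
def outflow (Ω : Set E3) (u : E3 → E3) (ρ : E3 → ℝ) (B : E3 → E3) (x : E3) : E3 :=
  (if ⟪(1 / 2 : ℝ) • u x - current ρ B x, outwardNormal Ω x⟫ < 0 then
      ⟪(1 / 2 : ℝ) • u x - current ρ B x, outwardNormal Ω x⟫ • B x
    else 0)
    + ⟪B x, outwardNormal Ω x⟫ • current ρ B x

/-- The time derivative `∂ₜ B`. -/
def dt (B : ℝ → E3 → E3) (t : ℝ) (x : E3) : E3 := deriv (fun s => B s x) t

/-- The regularity of data and solution on `(0, T) × Ω`, up to the boundary of `Ω` (`ContDiffAt` at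
a boundary point refers to a full neighbourhood of it): `B` is `C¹` in `(t, x)` and `C²` in `x`,
while `u` and `ρ` are `C¹` in `x`. -/
structure SufficientlySmooth (T : ℝ) (Ω : Set E3) (u : ℝ → E3 → E3) (ρ : ℝ → E3 → ℝ)
    (B : ℝ → E3 → E3) : Prop where
  field_joint : ∀ t ∈ Ioo 0 T, ∀ x ∈ closure Ω,
    ContDiffAt ℝ 1 (fun p : ℝ × E3 => B p.1 p.2) (t, x)
  field_space : ∀ t ∈ Ioo 0 T, ∀ x ∈ closure Ω, ContDiffAt ℝ 2 (B t) x
  velocity : ∀ t ∈ Ioo 0 T, ∀ x ∈ closure Ω, ContDiffAt ℝ 1 (u t) x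
  density : ∀ t ∈ Ioo 0 T, ∀ x ∈ closure Ω, ContDiffAt ℝ 1 (ρ t) x

/-- Strong implementation: the equation holds in `(0, T) × Ω` and the outflow condition holds at
the points of `∂Ω` (it reads `0 = 0` at points without a normal, where `outwardNormal` is `0`). -/
def IsStrongOutflowSolution (T : ℝ) (Ω : Set E3) (u : ℝ → E3 → E3) (ρ : ℝ → E3 → ℝ)
    (B : ℝ → E3 → E3) : Prop :=
  ∀ t ∈ Ioo 0 T,
    (∀ x ∈ Ω, dt B t x = splitRHS (u t) (ρ t) (B t) x) ∧
    (∀ x ∈ frontier Ω, outflow Ω (u t) (ρ t) (B t) x = 0)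

/-- Weak implementation: the equation with the additional term `L(outflow)` on its right hand side
holds as an identity of functionals on smooth test fields. -/
def IsWeakOutflowSolution (T : ℝ) (Ω : Set E3) (u : ℝ → E3 → E3) (ρ : ℝ → E3 → ℝ)
    (B : ℝ → E3 → E3) : Prop :=
  ∀ t ∈ Ioo 0 T, ∀ φ : E3 → E3, ContDiff ℝ ∞ φ →
    (∫ x in Ω, ⟪φ x, dt B t x⟫) =
      (∫ x in Ω, ⟪φ x, splitRHS (u t) (ρ t) (B t) x⟫)
        + lifting Ω (outflow Ω (u t) (ρ t) (B t)) φ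

end HallInduction

end

/-! Write `J = (∇ × B)/ρ`. Pairing the equation with `2B` gives the pointwise identity `2B·R =
2B·(B·∇)u - |B|² div u - div G`, with energy flux `G = |B|² u + 2((J·B)B - |B|² J)`
(`two_mul_inner_splitRHS`). The split form of the transport terms yields `-|B|² div u - div(|B|²
u)`. The Hall term is a pure divergence: `B·∇×(J×B) = div((J×B)×B) + (J×B)·(∇×B)`, and the last
product vanishes because `J` is parallel to `∇×B`. The constraint `div B = 0` is never needed.

On the boundary, `G·ν - 2B·ψ = 2|B|² max((u/2 - J)·ν, 0) ≥ 0` (`two_mul_inner_outflow_le`). After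
integration the boundary terms therefore have a favourable sign, whether `ψ` vanishes or enters
through the lifting. What remains is `2B·(B·∇)u - |B|² div u`, which is at most `(6 + 3) M |B|²`
when all `|∂ⱼuᵢ| ≤ M` (`two_mul_inner_advect_sub_le`).

Most of the work is the divergence theorem for bounded Lipschitz domains, with Hausdorff surface
measure and a normal defined geometrically (`IsBoundedLipschitzDomain.integral_divg`). It combines
an area formula for Lipschitz graphs (`comap_graphParam`), Gauss-Green below one graph
(`integral_fderiv_subgraph`), the a.e. identification of the normal
(`IsBoundaryChart.isOutwardUnitNormal` with Rademacher's theorem) and a partition of unity.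

Two analytic points complete the argument. In the weak form `B(t)` need not be an admissible test
field, so the identity is extended to continuous fields by uniform approximation. The energy is
differentiated under the integral by dominated convergence. -/

noncomputable section

namespace HallInduction

/-! ### Area of Lipschitz graphs -/

/-- The plane `ℝ²` with the Euclidean norm. -/
abbrev E2 : Type := EuclideanSpace ℝ (Fin 2)

/-- Cartesian coordinates of `ℝ³`, split into a plane and a line. -/
abbrev Chart : Type := E3 ≃ₗᵢ[ℝ] WithLp 2 (E2 × ℝ)

/-- The parametrization of the graph of `g` in the coordinates `e`. -/
def graphParam (e : Chart) (g : E2 → ℝ) (p : E2) : E3 := e.symm (WithLp.toLp 2 (p, g p))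

/-- The linear parametrization of the graph of a linear form. -/
def graphLin (e : Chart) (a : E2 →L[ℝ] ℝ) : E2 →L[ℝ] E3 :=
  (e.symm.toContinuousLinearEquiv : WithLp 2 (E2 × ℝ) →L[ℝ] E3) ∘L
    ((WithLp.prodContinuousLinearEquiv 2 ℝ E2 ℝ).symm : E2 × ℝ →L[ℝ] WithLp 2 (E2 × ℝ)) ∘L
      (ContinuousLinearMap.id ℝ E2).prod a

/-- The area density of the graph of `g`. -/
def areaDensity (g : E2 → ℝ) (p : E2) : ℝ := √(1 + ‖fderiv ℝ g p‖ ^ 2)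

theorem graphLin_apply (e : Chart) (a : E2 →L[ℝ] ℝ) (v : E2) :
    graphLin e a v = e.symm (WithLp.toLp 2 (v, a v)) := rfl

theorem norm_graphLin_sq (e : Chart) (a : E2 →L[ℝ] ℝ) (v : E2) :
    ‖graphLin e a v‖ ^ 2 = ‖v‖ ^ 2 + a v ^ 2 := by
  rw [graphLin_apply, LinearIsometryEquiv.norm_map, WithLp.prod_norm_sq_eq_of_L2]
  simp

theorem norm_le_norm_graphLin (e : Chart) (a : E2 →L[ℝ] ℝ) (v : E2) :
    ‖v‖ ≤ ‖graphLin e a v‖ := by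
  refine le_of_sq_le_sq ?_ (norm_nonneg _)
  rw [norm_graphLin_sq]
  nlinarith [sq_nonneg (a v)]

/-- If `w` is the Riesz vector of `a`, the Gram matrix of the images of the standard basis is `I + w
wᵀ`, with determinant `1 + |w|²`. -/
theorem normDet_graphLin (e : Chart) (a : E2 →L[ℝ] ℝ) :
    (graphLin e a : E2 →ₗ[ℝ] E3).normDet = √(1 + ‖a‖ ^ 2) := by
  rw [eq_comm, Real.sqrt_eq_iff_mul_self_eq (by positivity) (LinearMap.normDet_nonneg _), ← sq]
  have h := LinearMap.normDet_sq_eq_det_gram (graphLin e a : E2 →ₗ[ℝ] E3)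
    (EuclideanSpace.basisFun (Fin 2) ℝ)
  have hin : ∀ v w : E2, ⟪graphLin e a v, graphLin e a w⟫ = ⟪v, w⟫ + a v * a w := by
    intro v w
    rw [graphLin_apply, graphLin_apply, LinearIsometryEquiv.inner_map_map,
      WithLp.prod_inner_apply]
    simp [mul_comm]
  obtain ⟨w, rfl⟩ := (InnerProductSpace.toDual ℝ E2).surjective a
  have hw : ∀ i, ⟪w, EuclideanSpace.single i (1 : ℝ)⟫ = w i := fun i => by
    rw [EuclideanSpace.inner_single_right]; simp
  simp only [RCLike.ofReal_real_eq_id, id_eq] at h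
  rw [h, Matrix.det_fin_two]
  simp only [Matrix.gram_apply, ContinuousLinearMap.coe_coe, hin, EuclideanSpace.basisFun_apply,
    InnerProductSpace.toDual_apply_apply, hw, LinearIsometryEquiv.norm_map,
    EuclideanSpace.norm_sq_eq, Fin.sum_univ_two]
  simp [EuclideanSpace.inner_single_right]
  ring

/-- On `s` the map `f` factors through `h` by a `K`-Lipschitz map. This compares the areas of two
parametrized surfaces with a common parameter set. -/
theorem euclideanHausdorffMeasure_image_le_of_edist_le {X Y Z : Type*}
    [EMetricSpace Y] [MeasurableSpace Y] [BorelSpace Y]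
    [EMetricSpace Z] [MeasurableSpace Z] [BorelSpace Z] {f : X → Y} {h : X → Z} {s : Set X}
    {K : ℝ≥0} (H : ∀ p ∈ s, ∀ q ∈ s, edist (f p) (f q) ≤ K * edist (h p) (h q)) (d : ℕ) :
    μHE[d] (f '' s) ≤ (K : ENNReal) ^ d * μHE[d] (h '' s) := by
  rcases s.eq_empty_or_nonempty with rfl | ⟨x₀, hx₀⟩
  · simp
  have : Nonempty X := ⟨x₀⟩
  set φ : Z → Y := f ∘ Function.invFunOn h s
  have hmem : ∀ p ∈ s, Function.invFunOn h s (h p) ∈ s ∧ h (Function.invFunOn h s (h p)) = h p :=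
    fun p hp => ⟨Function.invFunOn_mem ⟨p, hp, rfl⟩, Function.invFunOn_eq ⟨p, hp, rfl⟩⟩
  have himg : φ '' (h '' s) = f '' s := by
    rw [image_image]
    refine image_congr fun p hp => ?_
    have := H _ (hmem p hp).1 p hp
    rw [(hmem p hp).2, edist_self, mul_zero, nonpos_iff_eq_zero, edist_eq_zero] at this
    exact this
  have hlip : LipschitzOnWith K φ (h '' s) := by
    rintro _ ⟨p, hp, rfl⟩ _ ⟨q, hq, rfl⟩
    have := H _ (hmem p hp).1 _ (hmem q hq).1
    rwa [(hmem p hp).2, (hmem q hq).2] at this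
  have := hlip.hausdorffMeasure_image_le (d := (d : ℝ)) (by positivity)
  rw [himg, ENNReal.rpow_natCast] at this
  rw [Measure.euclideanHausdorffMeasure_def, Measure.euclideanHausdorffMeasure_def,
    Measure.smul_apply, Measure.smul_apply, mul_smul_comm]
  gcongr

theorem euclideanHausdorffMeasure_image_graphLin (e : Chart) (a : E2 →L[ℝ] ℝ) (s : Set E2) :
    μHE[2] (graphLin e a '' s) = ENNReal.ofReal √(1 + ‖a‖ ^ 2) * volume s := by
  have h := (graphLin e a : E2 →ₗ[ℝ] E3).euclideanHausdorffMeasure_image_eq_normDet_mul_volume s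
  rw [normDet_graphLin] at h
  simpa using h

theorem norm_graphParam_sub_sq (e : Chart) (g : E2 → ℝ) (p q : E2) :
    ‖graphParam e g p - graphParam e g q‖ ^ 2 = ‖p - q‖ ^ 2 + (g p - g q) ^ 2 := by
  rw [graphParam, graphParam, ← map_sub, LinearIsometryEquiv.norm_map,
    WithLp.prod_norm_sq_eq_of_L2]
  simp

theorem graphParam_injective (e : Chart) (g : E2 → ℝ) : Function.Injective (graphParam e g) := by
  intro p q h
  have := norm_graphParam_sub_sq e g p q
  rw [h, sub_self, norm_zero] at this
  have h2 : ‖p - q‖ ^ 2 = 0 := by nlinarith [sq_nonneg ‖p - q‖, sq_nonneg (g p - g q)]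
  simpa [sub_eq_zero] using h2

theorem lipschitzWith_graphParam (e : Chart) {g : E2 → ℝ} {K : ℝ≥0} (hg : LipschitzWith K g) :
    LipschitzWith (1 + K) (graphParam e g) := by
  refine LipschitzWith.of_dist_le_mul fun p q => ?_
  rw [dist_eq_norm, dist_eq_norm]
  refine le_of_sq_le_sq ?_ (by positivity)
  rw [norm_graphParam_sub_sq]
  have h := hg.dist_le_mul p q
  rw [Real.dist_eq, dist_eq_norm] at h
  have h2 : (g p - g q) ^ 2 ≤ (K * ‖p - q‖) ^ 2 := by
    rw [← sq_abs (g p - g q)]; gcongr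
  push_cast
  nlinarith [mul_nonneg K.2 (sq_nonneg ‖p - q‖)]

theorem measurableEmbedding_graphParam (e : Chart) {g : E2 → ℝ} (hg : Continuous g) :
    MeasurableEmbedding (graphParam e g) := by
  refine Continuous.measurableEmbedding ?_ (graphParam_injective e g)
  unfold graphParam
  fun_prop

theorem hasFDerivAt_graphParam (e : Chart) {g : E2 → ℝ} {p : E2} (hg : DifferentiableAt ℝ g p) :
    HasFDerivAt (graphParam e g) (graphLin e (fderiv ℝ g p)) p := by
  have h : HasFDerivAt (fun q : E2 => (q, g q))
      ((ContinuousLinearMap.id ℝ E2).prod (fderiv ℝ g p)) p :=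
    (hasFDerivAt_id p).prodMk hg.hasFDerivAt
  exact ((e.symm.toContinuousLinearEquiv : WithLp 2 (E2 × ℝ) →L[ℝ] E3) ∘L
    ((WithLp.prodContinuousLinearEquiv 2 ℝ E2 ℝ).symm :
      E2 × ℝ →L[ℝ] WithLp 2 (E2 × ℝ))).hasFDerivAt.comp p h

/-- Since the tangent parametrization does not contract distances, the error `r‖p - q‖` is at most
`r` times the tangent distance. The graph and its tangent plane are thus bi-Lipschitz equivalent,
and each Lipschitz constant enters squared in dimension two. -/
theorem area_graphParam_le_of_approximatesLinearOn {e : Chart} {g : E2 → ℝ} {a : E2 →L[ℝ] ℝ}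
    {s : Set E2} {r : ℝ≥0} (hr : r ≤ 1 / 2)
    (h : ApproximatesLinearOn (graphParam e g) (graphLin e a) s r) :
    μHE[2] (graphParam e g '' s) ≤
        ((1 + 2 * r : ℝ≥0) : ENNReal) ^ 2 * (ENNReal.ofReal √(1 + ‖a‖ ^ 2) * volume s) ∧
      ENNReal.ofReal √(1 + ‖a‖ ^ 2) * volume s ≤
        ((1 + 2 * r : ℝ≥0) : ENNReal) ^ 2 * μHE[2] (graphParam e g '' s) := by
  have hr' : (r : ℝ) ≤ 1 / 2 := by exact_mod_cast hr
  have hr0 : (0 : ℝ) ≤ r := r.2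
  have key : ∀ p ∈ s, ∀ q ∈ s,
      ‖graphParam e g p - graphParam e g q‖ ≤
          (1 + 2 * r) * ‖graphLin e a p - graphLin e a q‖ ∧
        ‖graphLin e a p - graphLin e a q‖ ≤
          (1 + 2 * r) * ‖graphParam e g p - graphParam e g q‖ := by
    intro p hp q hq
    have h1 := h p hp q hq
    have h2 := norm_le_norm_graphLin e a (p - q)
    have h3 := mul_le_mul_of_nonneg_left h2 hr0
    rw [← map_sub]
    have h4 := abs_norm_sub_norm_le (graphParam e g p - graphParam e g q) (graphLin e a (p - q))
    have h5 := abs_le.1 (h4.trans (h1.trans h3))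
    have h6 := norm_nonneg (graphLin e a (p - q))
    constructor
    · nlinarith [mul_nonneg hr0 h6]
    -- Here `r ≤ 1/2` enters: it gives `(1 + 2r)(1 - r) ≥ 1`, which replaces `1/(1 - r)` by `1 +
    -- 2r`.
    · nlinarith [mul_nonneg hr0 h6, mul_nonneg (mul_nonneg hr0 h6) (sub_nonneg.2 hr')]
  rw [← euclideanHausdorffMeasure_image_graphLin e]
  constructor
  · refine euclideanHausdorffMeasure_image_le_of_edist_le (fun p hp q hq => ?_) 2
    rw [edist_dist, edist_dist, dist_eq_norm, dist_eq_norm, ← ENNReal.ofReal_coe_nnreal,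
      ← ENNReal.ofReal_mul (by positivity)]
    exact ENNReal.ofReal_le_ofReal (by exact_mod_cast (key p hp q hq).1)
  · refine euclideanHausdorffMeasure_image_le_of_edist_le (fun p hp q hq => ?_) 2
    rw [edist_dist, edist_dist, dist_eq_norm, dist_eq_norm, ← ENNReal.ofReal_coe_nnreal,
      ← ENNReal.ofReal_mul (by positivity)]
    exact ENNReal.ofReal_le_ofReal (by exact_mod_cast (key p hp q hq).2)

/-- Turns additive closeness of gradients into multiplicative closeness of area densities. -/
theorem sqrt_one_add_sq_le {x y δ : ℝ} (hx : 0 ≤ x) (hδ : 0 ≤ δ) (h : x ≤ y + δ) :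
    √(1 + x ^ 2) ≤ (1 + δ) * √(1 + y ^ 2) := by
  refine Real.sqrt_le_iff.2 ⟨by positivity, ?_⟩
  rw [mul_pow, Real.sq_sqrt (by positivity)]
  nlinarith [mul_nonneg hδ (sq_nonneg (y - 1)), mul_nonneg hδ (sq_nonneg y),
    mul_nonneg hδ hδ, sq_nonneg (δ * y)]

theorem measure_le_of_countable_cover {α : Type*} [MeasurableSpace α] {μ₁ μ₂ : Measure α}
    (t : ℕ → Set α) (ht : ∀ n, MeasurableSet (t n))
    (h : ∀ n, ∀ s ⊆ t n, MeasurableSet s → μ₁ s ≤ μ₂ s) (h0 : μ₁ (⋃ n, t n)ᶜ = 0) :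
    μ₁ ≤ μ₂ := by
  refine Measure.le_iff.2 fun A hA => ?_
  have hd : ∀ n, MeasurableSet (disjointed t n) := fun n => .disjointed ht n
  have hsplit : ∀ μ : Measure α, μ (A ∩ ⋃ n, t n) = ∑' n, μ (A ∩ disjointed t n) := by
    intro μ
    rw [← iUnion_disjointed, inter_iUnion, measure_iUnion]
    · exact fun i j hij => ((disjoint_disjointed t) hij).mono inter_subset_right inter_subset_right
    · exact fun n => hA.inter (hd n)
  calc μ₁ A ≤ μ₁ (A ∩ ⋃ n, t n) + μ₁ (⋃ n, t n)ᶜ := by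
        refine (measure_mono fun x hx => ?_).trans (measure_union_le _ _)
        by_cases hx' : x ∈ ⋃ n, t n
        · exact Or.inl ⟨hx, hx'⟩
        · exact Or.inr hx'
    _ = ∑' n, μ₁ (A ∩ disjointed t n) := by rw [h0, add_zero, hsplit]
    _ ≤ ∑' n, μ₂ (A ∩ disjointed t n) := ENNReal.tsum_le_tsum fun n =>
        h n _ (inter_subset_right.trans (disjointed_subset t n)) (hA.inter (hd n))
    _ = μ₂ (A ∩ ⋃ n, t n) := (hsplit _).symm
    _ ≤ μ₂ A := measure_mono inter_subset_left

theorem measurable_areaDensity (g : E2 → ℝ) : Measurable (areaDensity g) := by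
  have := measurable_fderiv ℝ g
  unfold areaDensity
  fun_prop

/-- The differentiability set splits into countably many pieces on which the gradient varies by at
most `2r` from a reference value and the graph is `r`-close to one tangent map. On each piece the
area formula holds up to `(1 + 2r)³`: two factors come from the change of area, one from freezing
the density. The remaining set is null by Rademacher's theorem. -/
theorem comap_graphParam_approx (e : Chart) {g : E2 → ℝ} {K : ℝ≥0} (hg : LipschitzWith K g)
    {r : ℝ≥0} (hr0 : 0 < r) (hr : r ≤ 1 / 2) :
    (μHE[2] : Measure E3).comap (graphParam e g) ≤ ((1 + 2 * r : ℝ≥0) : ENNReal) ^ 3 •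
        volume.withDensity (fun p => ENNReal.ofReal (areaDensity g p)) ∧
      volume.withDensity (fun p => ENNReal.ofReal (areaDensity g p)) ≤
        ((1 + 2 * r : ℝ≥0) : ENNReal) ^ 3 • (μHE[2] : Measure E3).comap (graphParam e g) := by
  set κ : ENNReal := ((1 + 2 * r : ℝ≥0) : ENNReal) with hκ
  have hS := measurableEmbedding_graphParam e hg.continuous
  have hJ : Measurable (fun p => ENNReal.ofReal (areaDensity g p)) :=
    (measurable_areaDensity g).ennreal_ofReal
  set D : Set E2 := {p | DifferentiableAt ℝ g p} with hD
  -- A countable dense set of linear forms; the balls of radius `r` around them sort the points by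
  -- gradient.
  set b : ℕ → (E2 →L[ℝ] ℝ) := TopologicalSpace.denseSeq _
  set Dk : ℕ → Set E2 := fun k => D ∩ {p | ‖fderiv ℝ g p - b k‖ < r} with hDk
  have hDkm : ∀ k, MeasurableSet (Dk k) := fun k => by
    refine (measurableSet_of_differentiableAt ℝ g).inter (measurableSet_lt ?_ measurable_const)
    exact ((measurable_fderiv ℝ g).sub_const _).norm
  choose t A _ htm htc hta htA using fun k =>
    exists_partition_approximatesLinearOn_of_hasFDerivWithinAt (graphParam e g) (Dk k)
      (fun p => graphLin e (fderiv ℝ g p))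
      (fun p hp => (hasFDerivAt_graphParam e hp.1).hasFDerivWithinAt) (fun _ => r)
      (fun _ => hr0.ne')
  set c : ℕ → Set E2 := fun n => Dk n.unpair.1 ∩ t n.unpair.1 n.unpair.2 with hc
  have hcm : ∀ n, MeasurableSet (c n) := fun n => (hDkm _).inter (htm _ _)
  have hcover : ⋃ n, c n = D := by
    refine subset_antisymm (iUnion_subset fun n p hp => hp.1.1) fun p hp => ?_
    obtain ⟨k, hk⟩ := (TopologicalSpace.denseRange_denseSeq (E2 →L[ℝ] ℝ)).exists_dist_lt
      (fderiv ℝ g p) (show (0 : ℝ) < r from hr0)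
    have hpk : p ∈ Dk k := ⟨hp, by rwa [dist_eq_norm] at hk⟩
    obtain ⟨n, hn⟩ := mem_iUnion.1 (htc k hpk)
    exact mem_iUnion.2 ⟨Nat.pair k n, by simpa [hc] using ⟨hpk, hn⟩⟩
  have hnull : volume Dᶜ = 0 := hg.ae_differentiableAt
  have hpiece : ∀ n, ∀ s ⊆ c n, MeasurableSet s →
      μHE[2] (graphParam e g '' s) ≤
          κ ^ 3 * ∫⁻ p in s, ENNReal.ofReal (areaDensity g p) ∧
        ∫⁻ p in s, ENNReal.ofReal (areaDensity g p) ≤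
          κ ^ 3 * μHE[2] (graphParam e g '' s) := by
    intro n s hs hsm
    rcases s.eq_empty_or_nonempty with rfl | ⟨x₀, hx₀⟩
    · simp
    -- The approximating linear map is the tangent map at some `y` of the same gradient class, so
    -- its density is comparable to the density at every point of `s`.
    obtain ⟨y, hy, hyA⟩ := htA n.unpair.1 ⟨x₀, (hs hx₀).1⟩ n.unpair.2
    have happ := (hta n.unpair.1 n.unpair.2).mono_set hs
    rw [hyA] at happ
    obtain ⟨h1, h2⟩ := area_graphParam_le_of_approximatesLinearOn hr happ
    rw [← hκ] at h1 h2
    have hκ' : κ = ENNReal.ofReal (1 + 2 * r) := by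
      rw [hκ, ← ENNReal.ofReal_coe_nnreal]; push_cast; rfl
    have hclose : ∀ p ∈ s, ‖fderiv ℝ g p - fderiv ℝ g y‖ ≤ 2 * r := fun p hp => by
      have hp1 : ‖fderiv ℝ g p - b n.unpair.1‖ < r := (hs hp).1.2
      have hy1 : ‖fderiv ℝ g y - b n.unpair.1‖ < r := hy.2
      have := norm_sub_le (fderiv ℝ g p - b n.unpair.1) (fderiv ℝ g y - b n.unpair.1)
      rw [sub_sub_sub_cancel_right] at this
      linarith
    have hr' : (0 : ℝ) ≤ 2 * r := by positivity
    have hJ1 : ∀ p ∈ s, ENNReal.ofReal (areaDensity g y) ≤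
        κ * ENNReal.ofReal (areaDensity g p) := fun p hp => by
      rw [hκ', ← ENNReal.ofReal_mul (by positivity)]
      refine ENNReal.ofReal_le_ofReal (sqrt_one_add_sq_le (norm_nonneg _) hr' ?_)
      have := norm_sub_norm_le (fderiv ℝ g y) (fderiv ℝ g p)
      rw [norm_sub_rev] at this
      linarith [hclose p hp]
    have hJ2 : ∀ p ∈ s, ENNReal.ofReal (areaDensity g p) ≤
        κ * ENNReal.ofReal (areaDensity g y) := fun p hp => by
      rw [hκ', ← ENNReal.ofReal_mul (by positivity)]
      refine ENNReal.ofReal_le_ofReal (sqrt_one_add_sq_le (norm_nonneg _) hr' ?_)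
      have := norm_sub_norm_le (fderiv ℝ g p) (fderiv ℝ g y)
      linarith [hclose p hp]
    constructor
    · calc μHE[2] (graphParam e g '' s)
          ≤ κ ^ 2 * (ENNReal.ofReal (areaDensity g y) * volume s) := h1
        _ = κ ^ 2 * ∫⁻ _ in s, ENNReal.ofReal (areaDensity g y) := by rw [setLIntegral_const]
        _ ≤ κ ^ 2 * ∫⁻ p in s, κ * ENNReal.ofReal (areaDensity g p) := by
            gcongr 1
            exact setLIntegral_mono' hsm hJ1
        _ = κ ^ 3 * ∫⁻ p in s, ENNReal.ofReal (areaDensity g p) := by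
            rw [lintegral_const_mul _ hJ, ← mul_assoc, ← pow_succ]
    · calc ∫⁻ p in s, ENNReal.ofReal (areaDensity g p)
          ≤ ∫⁻ _ in s, κ * ENNReal.ofReal (areaDensity g y) := setLIntegral_mono' hsm hJ2
        _ = κ * (ENNReal.ofReal (areaDensity g y) * volume s) := by
            rw [setLIntegral_const, mul_assoc]
        _ ≤ κ * (κ ^ 2 * μHE[2] (graphParam e g '' s)) := mul_le_mul' le_rfl h2
        _ = κ ^ 3 * μHE[2] (graphParam e g '' s) := by ring
  constructor
  · refine measure_le_of_countable_cover c hcm (fun n s hs hsm => ?_) ?_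
    · rw [hS.comap_apply, Measure.smul_apply, withDensity_apply _ hsm, smul_eq_mul]
      exact (hpiece n s hs hsm).1
    · rw [hcover, hS.comap_apply]
      -- Non-differentiability points carry no area: a Lipschitz image of a planar null set is null.
      have := euclideanHausdorffMeasure_image_le_of_edist_le (s := Dᶜ) (h := id)
        (fun p _ q _ => lipschitzWith_graphParam e hg p q) 2
      rw [image_id, EuclideanSpace.euclideanHausdorffMeasure_eq_volume, hnull, mul_zero] at this
      exact nonpos_iff_eq_zero.1 this
  · refine measure_le_of_countable_cover c hcm (fun n s hs hsm => ?_) ?_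
    · rw [Measure.smul_apply, hS.comap_apply, withDensity_apply _ hsm, smul_eq_mul]
      exact (hpiece n s hs hsm).2
    · rw [hcover]
      exact withDensity_absolutelyContinuous _ _ hnull

/-- **Area formula** for the graph of a Lipschitz function. -/
theorem comap_graphParam (e : Chart) {g : E2 → ℝ} {K : ℝ≥0} (hg : LipschitzWith K g) :
    (μHE[2] : Measure E3).comap (graphParam e g) =
      volume.withDensity (fun p => ENNReal.ofReal (areaDensity g p)) := by
  -- The distortion factor tends to `1` as `r → 0`, so both approximate inequalities become exact.
  have hlim : ∀ X : ENNReal, Filter.Tendsto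
      (fun r : ℝ≥0 => ((1 + 2 * r : ℝ≥0) : ENNReal) ^ 3 * X) (𝓝[>] 0) (𝓝 X) := by
    intro X
    have h1 : Continuous fun r : ℝ≥0 => ((1 + 2 * r : ℝ≥0) : ENNReal) ^ 3 := by fun_prop
    have h2 := ENNReal.Tendsto.mul_const (b := X)
      ((h1.tendsto 0).mono_left (nhdsWithin_le_nhds (s := Ioi 0)))
      (Or.inl (by simp))
    simpa using h2
  have happ : ∀ᶠ r : ℝ≥0 in 𝓝[>] 0, 0 < r ∧ r ≤ 1 / 2 :=
    Filter.Eventually.and self_mem_nhdsWithin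
      (nhdsWithin_le_nhds (Iic_mem_nhds (by simp)))
  refine le_antisymm (Measure.le_iff.2 fun s _ => ?_) (Measure.le_iff.2 fun s _ => ?_)
  · exact ge_of_tendsto (hlim _)
      (happ.mono fun r hr => (comap_graphParam_approx e hg hr.1 hr.2).1 s)
  · exact ge_of_tendsto (hlim _)
      (happ.mono fun r hr => (comap_graphParam_approx e hg hr.1 hr.2).2 s)

theorem restrict_range_graphParam (e : Chart) {g : E2 → ℝ} {K : ℝ≥0} (hg : LipschitzWith K g) :
    (μHE[2] : Measure E3).restrict (range (graphParam e g)) =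
      (volume.withDensity (fun p => ENNReal.ofReal (areaDensity g p))).map (graphParam e g) := by
  rw [← comap_graphParam e hg,
    (measurableEmbedding_graphParam e hg.continuous).map_comap]

theorem setIntegral_range_graphParam (e : Chart) {g : E2 → ℝ} {K : ℝ≥0} (hg : LipschitzWith K g)
    (h : E3 → ℝ) :
    ∫ x in range (graphParam e g), h x ∂μHE[2] =
      ∫ p, areaDensity g p * h (graphParam e g p) := by
  rw [restrict_range_graphParam e hg,
    (measurableEmbedding_graphParam e hg.continuous).integral_map,
    integral_withDensity_eq_integral_toReal_smul (measurable_areaDensity g).ennreal_ofReal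
      (by simp)]
  simp only [ENNReal.toReal_ofReal (Real.sqrt_nonneg _), areaDensity, smul_eq_mul]
/-! ### The divergence theorem below a Lipschitz graph -/

/-- The vertical shear which straightens the graph of `g`. -/
def graphShear (g : E2 → ℝ) (hg : Continuous g) : E2 × ℝ ≃ₜ E2 × ℝ where
  toFun q := (q.1, q.2 + g q.1)
  invFun q := (q.1, q.2 - g q.1)
  left_inv q := by simp
  right_inv q := by simp
  continuous_toFun := by fun_prop
  continuous_invFun := by fun_prop

theorem measurePreserving_graphShear {g : E2 → ℝ} (hg : Continuous g) :
    MeasurePreserving (graphShear g hg) volume volume := by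
  refine (MeasurePreserving.id (volume : Measure E2)).skew_product
    (g := fun p z => z + g p) ?_ (Filter.Eventually.of_forall fun p => ?_)
  · exact (by fun_prop : Continuous fun q : E2 × ℝ => q.2 + g q.1).measurable
  · exact map_add_right_eq_self _ _

theorem integral_lineDeriv_eq_zero {f : E2 → ℝ} {C : ℝ≥0} (hf : LipschitzWith C f)
    (hs : HasCompactSupport f) (v : E2) : ∫ x, lineDeriv ℝ f x v = 0 := by
  have h := LipschitzWith.integral_lineDeriv_mul_eq (μ := volume)
    (LipschitzWith.const' (K := 0) (1 : ℝ)) hf hs (-v)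
  have h0 : ∀ x, lineDeriv ℝ (fun _ : E2 => (1 : ℝ)) x (-v) = 0 := fun x => by
    simp [lineDeriv]
  simpa [h0] using h.symm

/-- The shear by `g` straightens the region to a half space. The direction `(w, s)` is split into
the tangential vector `(w, ∇g·w)` and the vertical remainder `s - ∇g·w`. The tangential part
integrates to zero on every horizontal slice; the vertical part is integrated by the fundamental
theorem of calculus. Only a.e. differentiability of `g` is used. -/
theorem integral_fderiv_subgraph {g : E2 → ℝ} {K : ℝ≥0} (hg : LipschitzWith K g)
    {k : E2 × ℝ → ℝ} (hk : ContDiff ℝ 1 k) (hs : HasCompactSupport k) (w : E2) (s : ℝ) :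
    ∫ q in {q : E2 × ℝ | q.2 < g q.1}, fderiv ℝ k q (w, s) =
      ∫ p, k (p, g p) * (s - fderiv ℝ g p w) := by
  set σ := graphShear g hg.continuous with hσ
  have hσ_apply : ∀ p z, σ (p, z) = (p, z + g p) := fun p z => rfl
  have hpre : σ ⁻¹' {q : E2 × ℝ | q.2 < g q.1} = univ ×ˢ Iio 0 := by
    ext ⟨p, z⟩
    simp [hσ_apply]
  rw [← (measurePreserving_graphShear hg.continuous).setIntegral_preimage_emb
    σ.measurableEmbedding, ← hσ, hpre]
  have hμ : (volume : Measure (E2 × ℝ)).restrict (univ ×ˢ Iio 0) =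
      (volume : Measure E2).prod (volume.restrict (Iio 0)) := by
    rw [Measure.volume_eq_prod, ← Measure.prod_restrict, Measure.restrict_univ]
  rw [hμ]
  set μ := (volume : Measure E2).prod ((volume : Measure ℝ).restrict (Iio 0)) with hμdef
  have hdk : Continuous (fderiv ℝ k) := hk.continuous_fderiv one_ne_zero
  have hdks : HasCompactSupport (fderiv ℝ k) := hs.fderiv ℝ
  have hint : ∀ c : E2 × ℝ, Integrable (fun q => fderiv ℝ k (σ q) c) μ := by
    intro c
    have h1 : Continuous fun q => fderiv ℝ k (σ q) c :=
      (hdk.comp σ.continuous).clm_apply continuous_const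
    have h2 : HasCompactSupport fun q => fderiv ℝ k (σ q) c :=
      (hdks.comp_homeomorph σ).comp_left (g := fun L : E2 × ℝ →L[ℝ] ℝ => L c) rfl
    have h3 : Integrable (fun q => fderiv ℝ k (σ q) c) (volume : Measure (E2 × ℝ)) :=
      h1.integrable_of_hasCompactSupport h2
    rw [← hμ]
    exact h3.restrict
  set m : E2 → ℝ := fun p => fderiv ℝ g p w with hm
  have hmm : Measurable m := measurable_fderiv_apply_const ℝ g w
  have hmb : ∀ p, ‖m p‖ ≤ K * ‖w‖ := fun p =>
    (fderiv ℝ g p).le_of_opNorm_le (norm_fderiv_le_of_lipschitz ℝ hg) w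
  have hmint : ∀ c : E2 × ℝ, Integrable (fun q : E2 × ℝ => m q.1 * fderiv ℝ k (σ q) c) μ :=
    fun c => (hint c).bdd_mul (c := K * ‖w‖) (hmm.comp measurable_fst).aestronglyMeasurable
      (Filter.Eventually.of_forall fun q => hmb q.1)
  have hdecomp : ∀ q : E2 × ℝ, fderiv ℝ k (σ q) (w, s) =
      (fderiv ℝ k (σ q) (w, 0) + m q.1 * fderiv ℝ k (σ q) (0, 1)) +
        (s - m q.1) * fderiv ℝ k (σ q) (0, 1) := by
    intro q
    have : ((w, s) : E2 × ℝ) = (w, 0) + s • (0, 1) := by simp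
    rw [this, map_add, map_smul, smul_eq_mul]
    ring
  have hint1 : Integrable (fun q : E2 × ℝ =>
      fderiv ℝ k (σ q) (w, 0) + m q.1 * fderiv ℝ k (σ q) (0, 1)) μ :=
    (hint (w, 0)).add (hmint (0, 1))
  have hint2 : Integrable (fun q : E2 × ℝ => (s - m q.1) * fderiv ℝ k (σ q) (0, 1)) μ := by
    simp only [sub_mul]
    exact ((hint (0, 1)).const_mul s).sub (hmint (0, 1))
  simp only [hdecomp]
  rw [integral_add hint1 hint2]
  -- At a.e. `p` the integrand is the derivative along `w` of `p ↦ k (p, z + g p)`, a Lipschitz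
  -- function of compact support for fixed `z`.
  have hz1 : ∫ q : E2 × ℝ, (fderiv ℝ k (σ q) (w, 0) + m q.1 * fderiv ℝ k (σ q) (0, 1)) ∂μ = 0 := by
    rw [hμdef, integral_prod_symm _ hint1]
    refine integral_eq_zero_of_ae (Filter.Eventually.of_forall fun z => ?_)
    obtain ⟨C, hC⟩ : ∃ C, LipschitzWith C k := hk.lipschitzWith_of_hasCompactSupport hs one_ne_zero
    have hlip : LipschitzWith (C * max 1 K) fun p => k (p, z + g p) := by
      refine hC.comp (g := fun p : E2 => (p, z + g p)) (LipschitzWith.id.prodMk ?_)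
      refine LipschitzWith.of_dist_le_mul fun p q => ?_
      rw [dist_add_left]
      exact hg.dist_le_mul p q
    have hcs : HasCompactSupport fun p => k (p, z + g p) := by
      refine (hs.comp_homeomorph σ).comp_isClosedEmbedding (g := fun p : E2 => (p, z)) ?_
      refine ⟨isEmbedding_prodMkLeft z, ?_⟩
      have : range (fun p : E2 => (p, z)) = univ ×ˢ {z} := by
        ext ⟨p, y⟩; simp [eq_comm]
      rw [this]
      exact isClosed_univ.prod isClosed_singleton
    have hzero := integral_lineDeriv_eq_zero hlip hcs w
    refine Eq.trans (integral_congr_ae ?_) hzero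
    filter_upwards [hg.ae_differentiableAt (μ := volume)] with p hp
    have hd : HasFDerivAt (fun p => k (p, z + g p))
        ((fderiv ℝ k (σ (p, z))) ∘L
          ((ContinuousLinearMap.id ℝ E2).prod (fderiv ℝ g p))) p := by
      have hkd : HasFDerivAt k (fderiv ℝ k (σ (p, z))) (p, z + g p) :=
        (hk.differentiable one_ne_zero).differentiableAt.hasFDerivAt
      have hgd : HasFDerivAt (fun p => (p, z + g p))
          ((ContinuousLinearMap.id ℝ E2).prod (fderiv ℝ g p)) p :=
        (hasFDerivAt_id p).prodMk (hp.hasFDerivAt.const_add z)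
      exact hkd.comp p hgd
    rw [hd.hasLineDerivAt w |>.lineDeriv]
    have : ((w, m p) : E2 × ℝ) = (w, 0) + m p • (0, 1) := by simp
    change _ = fderiv ℝ k (σ (p, z)) (w, m p)
    rw [this, map_add, map_smul, smul_eq_mul]
  rw [hz1, zero_add, hμdef, integral_prod _ hint2]
  refine integral_congr_ae (Filter.Eventually.of_forall fun p => ?_)
  simp only [integral_const_mul]
  rw [mul_comm]
  congr 1
  have hcd : ContDiff ℝ 1 fun z : ℝ => k (p, z + g p) := hk.comp (by fun_prop)
  have hcs : HasCompactSupport fun z : ℝ => k (p, z + g p) := by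
    refine (hs.comp_homeomorph σ).comp_isClosedEmbedding (g := fun z : ℝ => (p, z)) ?_
    refine ⟨isEmbedding_prodMkRight p, ?_⟩
    have : range (fun z : ℝ => (p, z)) = {p} ×ˢ univ := by
      ext ⟨p, y⟩; simp [eq_comm]
    rw [this]
    exact isClosed_singleton.prod isClosed_univ
  -- In sheared coordinates the graph sits at height `0`, which produces the boundary value `k (p, g
  -- p)`.
  have h := hcs.integral_Iic_deriv_eq hcd 0
  rw [zero_add] at h
  rw [← h, integral_Iic_eq_integral_Iio]
  refine integral_congr_ae (Filter.Eventually.of_forall fun z => ?_)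
  have hd : HasDerivAt (fun z : ℝ => k (p, z + g p)) (fderiv ℝ k (σ (p, z)) (0, 1)) z := by
    have hkd : HasFDerivAt k (fderiv ℝ k (σ (p, z))) (p, z + g p) :=
      (hk.differentiable one_ne_zero).differentiableAt.hasFDerivAt
    have hld : HasDerivAt (fun z : ℝ => (p, z + g p)) (0, 1) z :=
      (hasDerivAt_const z p).prodMk ((hasDerivAt_id z).add_const (g p))
    exact hkd.comp_hasDerivAt z hld
  exact hd.deriv.symm

theorem integral_fderiv_chart (e : Chart) {g : E2 → ℝ} {K : ℝ≥0} (hg : LipschitzWith K g)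
    {h : E3 → ℝ} (hh : ContDiff ℝ 1 h) (hs : HasCompactSupport h) (v : E3) :
    ∫ x in {x | (e x).snd < g (e x).fst}, fderiv ℝ h x v =
      ∫ p, h (graphParam e g p) * ((e v).snd - fderiv ℝ g p (e v).fst) := by
  set L : E3 ≃L[ℝ] E2 × ℝ :=
    e.toContinuousLinearEquiv.trans (WithLp.prodContinuousLinearEquiv 2 ℝ E2 ℝ) with hL
  have hLmp : MeasurePreserving L volume volume :=
    (WithLp.volume_preserving_ofLp E2 ℝ).comp e.measurePreserving
  have hk : ContDiff ℝ 1 (h ∘ L.symm) := hh.comp L.symm.contDiff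
  have hks : HasCompactSupport (h ∘ L.symm) := hs.comp_homeomorph L.symm.toHomeomorph
  have key := integral_fderiv_subgraph hg hk hks (e v).fst (e v).snd
  rw [← hLmp.setIntegral_preimage_emb L.toHomeomorph.measurableEmbedding] at key
  refine Eq.trans ?_ key
  refine setIntegral_congr_fun₀ ?_ ?_
  · exact ((measurableSet_lt (by fun_prop) (by have := hg.continuous; fun_prop))).nullMeasurableSet
  · intro x _
    have : fderiv ℝ (h ∘ L.symm) (L x) = (fderiv ℝ h x) ∘L (L.symm : E2 × ℝ →L[ℝ] E3) := by
      rw [L.symm.comp_right_fderiv, L.symm_apply_apply]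
    simp only
    rw [this]
    change _ = fderiv ℝ h x (L.symm (L v))
    rw [L.symm_apply_apply]

/-! ### Boundary charts of a Lipschitz domain -/

/-- In `U`, the set `Ω` is the region below the graph of the Lipschitz function `g` in the
coordinates `e`. -/
structure IsBoundaryChart (Ω U : Set E3) (e : Chart) (g : E2 → ℝ) (K : ℝ≥0) : Prop where
  isOpen : IsOpen U
  lipschitz : LipschitzWith K g
  mem_iff : ∀ y ∈ U, y ∈ Ω ↔ (e y).snd < g (e y).fst

/-- The upward unit normal of the graph of `g`. -/
def graphNormal (e : Chart) (g : E2 → ℝ) (p : E2) : E3 :=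
  (areaDensity g p)⁻¹ • e.symm (WithLp.toLp 2 (-(InnerProductSpace.toDual ℝ E2).symm (fderiv ℝ g p), 1))

theorem areaDensity_pos (g : E2 → ℝ) (p : E2) : 0 < areaDensity g p :=
  Real.sqrt_pos.2 (by positivity)

theorem one_le_areaDensity (g : E2 → ℝ) (p : E2) : 1 ≤ areaDensity g p :=
  Real.one_le_sqrt.2 (by nlinarith [sq_nonneg ‖fderiv ℝ g p‖])

theorem apply_graphParam (e : Chart) (g : E2 → ℝ) (p : E2) :
    e (graphParam e g p) = WithLp.toLp 2 (p, g p) := e.apply_symm_apply _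

theorem continuous_graphParam (e : Chart) {g : E2 → ℝ} (hg : Continuous g) :
    Continuous (graphParam e g) := by
  unfold graphParam
  fun_prop

theorem mem_range_graphParam {e : Chart} {g : E2 → ℝ} {y : E3} :
    y ∈ range (graphParam e g) ↔ (e y).snd = g (e y).fst := by
  constructor
  · rintro ⟨p, rfl⟩
    simp [apply_graphParam]
  · intro h
    refine ⟨(e y).fst, ?_⟩
    rw [graphParam, ← h]
    exact e.symm_apply_apply y

/-- Multiplied by the area density, this is exactly the boundary weight `s - ∇g·w` of the flat
Gauss-Green formula. -/
theorem inner_graphNormal (e : Chart) (g : E2 → ℝ) (p : E2) (y : E3) :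
    ⟪y, graphNormal e g p⟫ =
      (areaDensity g p)⁻¹ * ((e y).snd - fderiv ℝ g p (e y).fst) := by
  rw [graphNormal, real_inner_smul_right]
  congr 1
  rw [← e.inner_map_map, e.apply_symm_apply, WithLp.prod_inner_apply]
  simp only [inner_neg_right]
  rw [real_inner_comm, InnerProductSpace.toDual_symm_apply]
  simp
  ring

theorem norm_graphNormal (e : Chart) (g : E2 → ℝ) (p : E2) : ‖graphNormal e g p‖ = 1 := by
  have h : ‖e.symm (WithLp.toLp 2
      (-(InnerProductSpace.toDual ℝ E2).symm (fderiv ℝ g p), (1 : ℝ)))‖ = areaDensity g p := by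
    rw [LinearIsometryEquiv.norm_map, WithLp.prod_norm_eq_of_L2, areaDensity]
    simp [add_comm]
  rw [graphNormal, norm_smul, h, Real.norm_of_nonneg (inv_nonneg.2 (areaDensity_pos g p).le),
    inv_mul_cancel₀ (areaDensity_pos g p).ne']

theorem measurable_graphNormal (e : Chart) (g : E2 → ℝ) : Measurable (graphNormal e g) := by
  have h1 := (measurable_areaDensity g).inv
  have h2 := measurable_fderiv ℝ g
  have h3 : Continuous fun L : E2 →L[ℝ] ℝ => e.symm (WithLp.toLp 2
      (-(InnerProductSpace.toDual ℝ E2).symm L, (1 : ℝ))) := by fun_prop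
  exact h1.smul (h3.measurable.comp h2)

theorem outwardNormal_eq {Ω : Set E3} {x n : E3} (h : IsOutwardUnitNormal Ω x n) :
    outwardNormal Ω x = n := by
  have hex : ∃ n, IsOutwardUnitNormal Ω x n := ⟨n, h⟩
  rw [outwardNormal, dif_pos hex]
  exact hex.choose_spec.unique h

theorem norm_outwardNormal_le (Ω : Set E3) (x : E3) : ‖outwardNormal Ω x‖ ≤ 1 := by
  unfold outwardNormal
  split_ifs with h
  · exact h.choose_spec.1.le
  · simp

namespace IsBoundaryChart

variable {Ω U : Set E3} {e : Chart} {g : E2 → ℝ} {K : ℝ≥0}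

/-- Up to the factor `areaDensity⁻¹ ≤ 1`, the inner product is the signed height of `y` over the
graph plus the first-order Taylor error of `g`. The height has the sign dictated by membership in
`Ω`, and the error is at most `ε‖y - x‖`. -/
theorem isOutwardUnitNormal (hc : IsBoundaryChart Ω U e g K) {p : E2}
    (hp : graphParam e g p ∈ U) (hg : DifferentiableAt ℝ g p) :
    IsOutwardUnitNormal Ω (graphParam e g p) (graphNormal e g p) := by
  refine ⟨norm_graphNormal e g p, fun ε hε => ?_⟩
  have hlim : Filter.Tendsto (fun y : E3 => (e y).fst) (𝓝 (graphParam e g p)) (𝓝 p) := by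
    have h : Continuous fun y : E3 => (e y).fst := by fun_prop
    have h2 := h.tendsto (graphParam e g p)
    rwa [apply_graphParam] at h2
  have hlo := hlim.eventually ((hasFDerivAt_iff_isLittleO.1 hg.hasFDerivAt).def hε)
  filter_upwards [hlo, hc.isOpen.mem_nhds hp] with y hy hyU
  have hJ := inv_le_one_of_one_le₀ (one_le_areaDensity g p)
  have hJ0 := inv_pos.2 (areaDensity_pos g p)
  rw [inner_graphNormal, map_sub, apply_graphParam, hc.mem_iff y hyU]
  have hfst : ‖(e y).fst - p‖ ≤ ‖y - graphParam e g p‖ := by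
    have h1 : ‖e (y - graphParam e g p)‖ = ‖y - graphParam e g p‖ := e.norm_map _
    rw [← h1, map_sub, apply_graphParam]
    refine le_of_sq_le_sq ?_ (norm_nonneg _)
    rw [WithLp.prod_norm_sq_eq_of_L2]
    simp only [WithLp.sub_fst]
    exact le_add_of_nonneg_right (sq_nonneg _)
  rw [Real.norm_eq_abs, abs_le] at hy
  have hε' := mul_le_mul_of_nonneg_left hfst hε.le
  set R := ‖y - graphParam e g p‖ with hR
  have hR0 : 0 ≤ ε * R := by positivity
  simp only [WithLp.sub_fst, WithLp.sub_snd]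
  set D := fderiv ℝ g p ((e y).fst - p) with hD
  constructor
  · intro h
    have : (e y).snd - g p - D ≤ ε * R := by linarith [hy.2]
    calc (areaDensity g p)⁻¹ * ((e y).snd - g p - D) ≤ (areaDensity g p)⁻¹ * (ε * R) := by gcongr
      _ ≤ 1 * (ε * R) := by gcongr
      _ = ε * R := one_mul _
  · intro h
    have : -(ε * R) ≤ (e y).snd - g p - D := by linarith [hy.1, not_lt.1 h]
    calc -(ε * R) = -(1 * (ε * R)) := by ring
      _ ≤ -((areaDensity g p)⁻¹ * (ε * R)) := by gcongr
      _ = (areaDensity g p)⁻¹ * -(ε * R) := by ring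
      _ ≤ _ := mul_le_mul_of_nonneg_left this hJ0.le

theorem frontier_inter (hc : IsBoundaryChart Ω U e g K) :
    frontier Ω ∩ U = range (graphParam e g) ∩ U := by
  set Ω' : Set E3 := {y | (e y).snd < g (e y).fst} with hΩ'
  have hgc := hc.lipschitz.continuous
  have hopen : IsOpen Ω' := isOpen_lt (by fun_prop) (by fun_prop)
  have hEq : Ω ∩ U = Ω' ∩ U := by
    ext y
    exact ⟨fun h => ⟨(hc.mem_iff y h.2).1 h.1, h.2⟩, fun h => ⟨(hc.mem_iff y h.2).2 h.1, h.2⟩⟩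
  rw [← frontier_inter_open_inter hc.isOpen, hEq, frontier_inter_open_inter hc.isOpen]
  congr 1
  ext y
  rw [mem_range_graphParam]
  constructor
  · intro h
    exact frontier_lt_subset_eq (f := fun y : E3 => (e y).snd) (g := fun y => g (e y).fst)
      (by fun_prop) (by fun_prop) h
  · intro h
    rw [hopen.frontier_eq]
    refine ⟨?_, fun h' => (h' : (e y).snd < _).ne h⟩
    -- Points of the graph are limits of points vertically below them.
    have hl : Continuous fun δ : ℝ => y - e.symm (WithLp.toLp 2 ((0 : E2), δ)) := by fun_prop
    have hl0 := hl.tendsto 0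
    have hz : WithLp.toLp 2 ((0 : E2), (0 : ℝ)) = 0 := rfl
    simp only [hz, map_zero, sub_zero] at hl0
    refine mem_closure_of_tendsto (hl0.mono_left (nhdsWithin_le_nhds (s := Ioi 0))) ?_
    filter_upwards [self_mem_nhdsWithin] with δ hδ
    have hδ' : (0 : ℝ) < δ := hδ
    change (e (y - e.symm (WithLp.toLp 2 ((0 : E2), δ)))).snd <
      g (e (y - e.symm (WithLp.toLp 2 ((0 : E2), δ)))).fst
    rw [map_sub, e.apply_symm_apply]
    simp [h, hδ']

theorem restrict_frontier_inter (hc : IsBoundaryChart Ω U e g K) :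
    (μHE[2] : Measure E3).restrict (frontier Ω ∩ U) =
      ((volume.withDensity (fun p => ENNReal.ofReal (areaDensity g p))).restrict
        (graphParam e g ⁻¹' U)).map (graphParam e g) := by
  rw [hc.frontier_inter, inter_comm, ← Measure.restrict_restrict hc.isOpen.measurableSet,
    restrict_range_graphParam e hc.lipschitz, Measure.restrict_map
      (continuous_graphParam e hc.lipschitz.continuous).measurable hc.isOpen.measurableSet]

theorem ae_outwardNormal_eq (hc : IsBoundaryChart Ω U e g K) :
    ∀ᵐ p, graphParam e g p ∈ U → outwardNormal Ω (graphParam e g p) = graphNormal e g p := by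
  filter_upwards [hc.lipschitz.ae_differentiableAt (μ := volume)] with p hp hpU
  exact outwardNormal_eq (hc.isOutwardUnitNormal hpU hp)

/-- The normal is defined by choice, so measurability is inherited from the explicit `graphNormal`,
with which it agrees a.e. -/
theorem aestronglyMeasurable_outwardNormal (hc : IsBoundaryChart Ω U e g K) :
    AEStronglyMeasurable (outwardNormal Ω) ((μHE[2] : Measure E3).restrict (frontier Ω ∩ U)) := by
  rw [hc.restrict_frontier_inter,
    (measurableEmbedding_graphParam e hc.lipschitz.continuous).aestronglyMeasurable_map_iff]
  refine (measurable_graphNormal e g).aestronglyMeasurable.congr ?_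
  have hV : MeasurableSet (graphParam e g ⁻¹' U) :=
    (continuous_graphParam e hc.lipschitz.continuous).measurable hc.isOpen.measurableSet
  refine (ae_restrict_iff' hV).2 ?_
  refine (withDensity_absolutelyContinuous _ _).ae_le ?_
  filter_upwards [hc.ae_outwardNormal_eq] with p hp hpU
  exact (hp hpU).symm

/-- The parametrization does not contract distances, so the parameter set is bounded, and the area
density is at most `√(1 + K²)`. -/
theorem measure_frontier_inter_lt_top (hc : IsBoundaryChart Ω U e g K)
    (hU : Bornology.IsBounded U) : (μHE[2] : Measure E3) (frontier Ω ∩ U) < ⊤ := by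
  have hS := continuous_graphParam e hc.lipschitz.continuous
  rw [hc.frontier_inter, inter_comm, ← Measure.restrict_apply hc.isOpen.measurableSet,
    restrict_range_graphParam e hc.lipschitz, Measure.map_apply hS.measurable
      hc.isOpen.measurableSet, withDensity_apply _ (hS.measurable hc.isOpen.measurableSet)]
  have hb : Bornology.IsBounded (graphParam e g ⁻¹' U) := by
    refine AntilipschitzWith.isBounded_preimage (K := 1) (f := graphParam e g) ?_ hU
    refine AntilipschitzWith.of_le_mul_dist fun p q => ?_
    rw [NNReal.coe_one, one_mul, dist_eq_norm, dist_eq_norm]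
    refine le_of_sq_le_sq ?_ (norm_nonneg _)
    rw [norm_graphParam_sub_sq]
    exact le_add_of_nonneg_right (sq_nonneg _)
  refine (setLIntegral_mono' (hS.measurable hc.isOpen.measurableSet)
    (g := fun _ => ENNReal.ofReal √(1 + (K : ℝ) ^ 2)) fun p _ => ?_).trans_lt ?_
  · refine ENNReal.ofReal_le_ofReal (Real.sqrt_le_sqrt ?_)
    have := norm_fderiv_le_of_lipschitz ℝ hc.lipschitz (x₀ := p)
    gcongr
  · rw [setLIntegral_const]
    exact ENNReal.mul_lt_top ENNReal.ofReal_lt_top hb.measure_lt_top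

/-- The divergence theorem for a function supported in a boundary chart. -/
theorem integral_fderiv (hc : IsBoundaryChart Ω U e g K) (hΩ : IsOpen Ω) {h : E3 → ℝ}
    (hh : ContDiff ℝ 1 h) (hs : HasCompactSupport h) (hU : tsupport h ⊆ U) (v : E3) :
    ∫ x in Ω, fderiv ℝ h x v =
      ∫ x in frontier Ω, h x * ⟪v, outwardNormal Ω x⟫ ∂μHE[2] := by
  have hgc := hc.lipschitz.continuous
  have hopen : IsOpen {y : E3 | (e y).snd < g (e y).fst} := isOpen_lt (by fun_prop) (by fun_prop)
  have hS := measurableEmbedding_graphParam e hgc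
  have h0 : ∀ x ∉ U, h x = 0 := fun x hx => image_eq_zero_of_notMem_tsupport fun h => hx (hU h)
  have h1 : ∀ x ∉ U, fderiv ℝ h x v = 0 := fun x hx => by
    rw [fderiv_of_notMem_tsupport ℝ fun h => hx (hU h)]; rfl
  have hL : ∫ x in Ω, fderiv ℝ h x v =
      ∫ x in {y : E3 | (e y).snd < g (e y).fst}, fderiv ℝ h x v := by
    rw [← integral_indicator hΩ.measurableSet, ← integral_indicator hopen.measurableSet]
    congr 1
    ext x
    by_cases hx : x ∈ U
    · have hiff : x ∈ Ω ↔ x ∈ {y : E3 | (e y).snd < g (e y).fst} := hc.mem_iff x hx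
      by_cases hxΩ : x ∈ Ω
      · rw [indicator_of_mem hxΩ, indicator_of_mem (hiff.1 hxΩ)]
      · rw [indicator_of_notMem hxΩ, indicator_of_notMem fun h => hxΩ (hiff.2 h)]
    · simp [indicator, h1 x hx]
  have hR : ∫ x in frontier Ω, h x * ⟪v, outwardNormal Ω x⟫ ∂μHE[2] =
      ∫ x in range (graphParam e g), h x * ⟪v, outwardNormal Ω x⟫ ∂μHE[2] := by
    rw [← integral_indicator isClosed_frontier.measurableSet,
      ← integral_indicator hS.measurableSet_range]
    congr 1
    ext x
    by_cases hx : x ∈ U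
    · have hiff : x ∈ frontier Ω ↔ x ∈ range (graphParam e g) := by
        have := Set.ext_iff.1 hc.frontier_inter x
        simpa [hx] using this
      by_cases hxΩ : x ∈ frontier Ω
      · rw [indicator_of_mem hxΩ, indicator_of_mem (hiff.1 hxΩ)]
      · rw [indicator_of_notMem hxΩ, indicator_of_notMem fun h => hxΩ (hiff.2 h)]
    · simp [indicator, h0 x hx]
  rw [hL, hR, integral_fderiv_chart e hc.lipschitz hh hs, setIntegral_range_graphParam e hc.lipschitz]
  refine integral_congr_ae ?_
  filter_upwards [hc.ae_outwardNormal_eq] with p hp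
  by_cases hpU : graphParam e g p ∈ U
  -- The area density of the surface measure cancels the normalisation of the normal.
  · rw [hp hpU, inner_graphNormal]
    have := (areaDensity_pos g p).ne'
    field_simp
  · rw [h0 _ hpU]
    ring

end IsBoundaryChart

/-! ### The divergence theorem on a bounded Lipschitz domain -/

theorem nonempty_chart : Nonempty Chart := by
  have h : Module.finrank ℝ E3 = Module.finrank ℝ (WithLp 2 (E2 × ℝ)) := by
    rw [(WithLp.linearEquiv 2 ℝ (E2 × ℝ)).finrank_eq, Module.finrank_prod]
    simp
  exact ⟨(stdOrthonormalBasis ℝ E3).equiv (stdOrthonormalBasis ℝ (WithLp 2 (E2 × ℝ)))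
    (finCongr h)⟩

theorem IsBoundaryChart.mono {Ω U U' : Set E3} {e : Chart} {g : E2 → ℝ} {K : ℝ≥0}
    (hc : IsBoundaryChart Ω U e g K) (hU' : IsOpen U') (h : U' ⊆ U) :
    IsBoundaryChart Ω U' e g K :=
  ⟨hU', hc.lipschitz, fun y hy => hc.mem_iff y (h hy)⟩

/-- Around interior points a constant function serves as a chart. -/
theorem isBoundaryChart_const {Ω U : Set E3} (hU : IsOpen U) (hUΩ : U ⊆ Ω) (e : Chart) {M : ℝ}
    (hM : ∀ y ∈ U, ‖y‖ < M) : IsBoundaryChart Ω U e (fun _ => M) 0 := by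
  refine ⟨hU, LipschitzWith.const M, fun y hy => iff_of_true (hUΩ hy) ?_⟩
  calc (e y).snd ≤ ‖(e y).snd‖ := Real.le_norm_self _
    _ ≤ ‖e y‖ := WithLp.norm_snd_le _ _
    _ = ‖y‖ := e.norm_map y
    _ < M := hM y hy

namespace IsBoundedLipschitzDomain

variable {Ω : Set E3}

theorem isCompact_closure (hΩ : IsBoundedLipschitzDomain Ω) : IsCompact (closure Ω) :=
  hΩ.isBounded.isCompact_closure

/-- Interior points are included, with a constant graph lying above them, so that one kind of chart
covers all of `closure Ω`. -/
theorem exists_chart (hΩ : IsBoundedLipschitzDomain Ω) {V : Set E3} (hV : IsOpen V)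
    {x : E3} (hx : x ∈ closure Ω) (hxV : x ∈ V) :
    ∃ (U : Set E3) (e : Chart) (g : E2 → ℝ) (K : ℝ≥0), x ∈ U ∧ U ⊆ V ∧
      Bornology.IsBounded U ∧ IsBoundaryChart Ω U e g K := by
  by_cases hxΩ : x ∈ Ω
  · obtain ⟨e⟩ := nonempty_chart
    obtain ⟨M, hM⟩ := hΩ.isBounded.exists_norm_le
    refine ⟨Ω ∩ V, e, fun _ => M + 1, 0, ⟨hxΩ, hxV⟩, inter_subset_right,
      hΩ.isBounded.subset inter_subset_left,
      isBoundaryChart_const (hΩ.isOpen.inter hV) inter_subset_left e fun y hy => ?_⟩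
    linarith [hM y hy.1]
  · have hfr : x ∈ frontier Ω := by
      rw [hΩ.isOpen.frontier_eq]
      exact ⟨hx, hxΩ⟩
    obtain ⟨U, hU, e, K, g, hg, h⟩ := hΩ.locally_subgraph x hfr
    refine ⟨interior U ∩ V ∩ Metric.ball x 1, e, g, K,
      ⟨⟨mem_interior_iff_mem_nhds.2 hU, hxV⟩, Metric.mem_ball_self one_pos⟩,
      fun y hy => hy.1.2, Metric.isBounded_ball.subset inter_subset_right,
      (isOpen_interior.inter hV).inter Metric.isOpen_ball, hg,
      fun y hy => h y (interior_subset hy.1.1)⟩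

theorem exists_finite_charts (hΩ : IsBoundedLipschitzDomain Ω) {V : Set E3} (hV : IsOpen V)
    (hΩV : closure Ω ⊆ V) :
    ∃ (s : Finset E3) (U : s → Set E3) (e : s → Chart) (g : s → E2 → ℝ) (K : s → ℝ≥0),
      (∀ i, U i ⊆ V) ∧ (∀ i, Bornology.IsBounded (U i)) ∧
      (∀ i, IsBoundaryChart Ω (U i) (e i) (g i) (K i)) ∧ closure Ω ⊆ ⋃ i, U i := by
  have := nonempty_chart
  choose! U e g K hxU hUV hb hc using fun x (hx : x ∈ closure Ω) =>
    hΩ.exists_chart hV hx (hΩV hx)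
  obtain ⟨s, hs, hcov⟩ := hΩ.isCompact_closure.elim_nhds_subcover U
    fun x hx => (hc x hx).isOpen.mem_nhds (hxU x hx)
  refine ⟨s, fun i => U i, fun i => e i, fun i => g i, fun i => K i, fun i => hUV i (hs i i.2),
    fun i => hb i (hs i i.2), fun i => hc i (hs i i.2), fun x hx => ?_⟩
  obtain ⟨y, hy, hxy⟩ := mem_iUnion₂.1 (hcov hx)
  exact mem_iUnion.2 ⟨⟨y, hy⟩, hxy⟩

theorem measure_frontier_lt_top (hΩ : IsBoundedLipschitzDomain Ω) :
    (μHE[2] : Measure E3) (frontier Ω) < ⊤ := by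
  obtain ⟨s, U, e, g, K, -, hb, hc, hcov⟩ := hΩ.exists_finite_charts isOpen_univ (subset_univ _)
  have hsub : frontier Ω ⊆ ⋃ i, frontier Ω ∩ U i := by
    rw [← inter_iUnion]
    exact subset_inter subset_rfl (frontier_subset_closure.trans hcov)
  refine (measure_mono hsub).trans_lt ((measure_iUnion_le _).trans_lt ?_)
  rw [tsum_fintype]
  exact ENNReal.sum_lt_top.2 fun i _ => (hc i).measure_frontier_inter_lt_top (hb i)

theorem isFiniteMeasure_frontier (hΩ : IsBoundedLipschitzDomain Ω) :
    IsFiniteMeasure ((μHE[2] : Measure E3).restrict (frontier Ω)) :=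
  ⟨by rw [Measure.restrict_apply_univ]; exact hΩ.measure_frontier_lt_top⟩

theorem aestronglyMeasurable_outwardNormal (hΩ : IsBoundedLipschitzDomain Ω) :
    AEStronglyMeasurable (outwardNormal Ω) ((μHE[2] : Measure E3).restrict (frontier Ω)) := by
  obtain ⟨s, U, e, g, K, -, -, hc, hcov⟩ := hΩ.exists_finite_charts isOpen_univ (subset_univ _)
  have hEq : frontier Ω = ⋃ i, frontier Ω ∩ U i := by
    rw [← inter_iUnion]
    exact (inter_eq_left.2 (frontier_subset_closure.trans hcov)).symm
  rw [hEq]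
  exact aestronglyMeasurable_iUnion_iff.2 fun i => (hc i).aestronglyMeasurable_outwardNormal

theorem integrableOn_of_continuousOn {F : Type*} [NormedAddCommGroup F]
    (hΩ : IsBoundedLipschitzDomain Ω) {f : E3 → F} (hf : ContinuousOn f (closure Ω)) :
    IntegrableOn f Ω :=
  (hf.integrableOn_compact hΩ.isCompact_closure).mono_set subset_closure

theorem aestronglyMeasurable_frontier {F : Type*} [NormedAddCommGroup F]
    [SecondCountableTopology F] {f : E3 → F} (hf : ContinuousOn f (closure Ω)) :
    AEStronglyMeasurable f ((μHE[2] : Measure E3).restrict (frontier Ω)) := by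
  borelize F
  exact (hf.mono frontier_subset_closure).aestronglyMeasurable isClosed_frontier.measurableSet

theorem integrableOn_frontier_mul_inner (hΩ : IsBoundedLipschitzDomain Ω) {f : E3 → ℝ}
    (hf : ContinuousOn f (closure Ω)) (v : E3) :
    IntegrableOn (fun x => f x * ⟪v, outwardNormal Ω x⟫) (frontier Ω) μHE[2] := by
  have := hΩ.isFiniteMeasure_frontier
  obtain ⟨C, hC⟩ := hΩ.isCompact_closure.exists_bound_of_continuousOn hf
  refine Integrable.of_bound ((aestronglyMeasurable_frontier hf).mul
      (aestronglyMeasurable_const.inner hΩ.aestronglyMeasurable_outwardNormal))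
    (C * ‖v‖) ?_
  refine (ae_restrict_iff' isClosed_frontier.measurableSet).2 (.of_forall fun x hx => ?_)
  rw [norm_mul]
  have h1 := hC x (frontier_subset_closure hx)
  have h2 : ‖⟪v, outwardNormal Ω x⟫‖ ≤ ‖v‖ :=
    (norm_inner_le_norm _ _).trans
      (mul_le_of_le_one_right (norm_nonneg _) (norm_outwardNormal_le Ω x))
  exact mul_le_mul h1 h2 (norm_nonneg _) ((norm_nonneg _).trans h1)

/-- The Gauss-Green formula for a scalar function. -/
theorem integral_fderiv (hΩ : IsBoundedLipschitzDomain Ω) {f : E3 → ℝ}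
    (hf : ∀ x ∈ closure Ω, ContDiffAt ℝ 1 f x) (v : E3) :
    ∫ x in Ω, fderiv ℝ f x v = ∫ x in frontier Ω, f x * ⟪v, outwardNormal Ω x⟫ ∂μHE[2] := by
  -- Charts are taken inside the open set where `f` is `C¹`, so each product of a cutoff with `f` is
  -- `C¹` on the whole space.
  set V : Set E3 := {x | ContDiffAt ℝ 1 f x} with hVdef
  have hV : IsOpen V := isOpen_iff_eventually.2 fun x (hx : ContDiffAt ℝ 1 f x) =>
    hx.eventually (by simp)
  obtain ⟨s, U, e, g, K, hUV, hb, hc, hcov⟩ := hΩ.exists_finite_charts hV hf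
  obtain ⟨χ, hχ⟩ := SmoothPartitionOfUnity.exists_isSubordinate (modelWithCornersSelf ℝ E3)
    (isClosed_closure (s := Ω)) U (fun i => (hc i).isOpen) hcov
  have hsum : ∀ x ∈ closure Ω, ∑ i, χ i x = 1 := fun x hx => by
    rw [← finsum_eq_sum_of_fintype]
    exact χ.sum_eq_one hx
  have hχs : ∀ i, ContDiff ℝ 1 (χ i) := fun i =>
    ((χ i).contMDiff.contDiff).of_le (by exact_mod_cast le_top)
  set h : s → E3 → ℝ := fun i x => χ i x * f x with hh
  have hts : ∀ i, tsupport (h i) ⊆ tsupport (χ i) := fun i => tsupport_mul_subset_left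
  have hcd : ∀ i, ContDiff ℝ 1 (h i) := fun i => by
    refine contDiff_iff_contDiffAt.2 fun x => ?_
    by_cases hx : x ∈ tsupport (χ i)
    · exact (hχs i).contDiffAt.mul (hUV i (hχ i hx))
    · have h0 : h i =ᶠ[𝓝 x] fun _ => 0 :=
        notMem_tsupport_iff_eventuallyEq.1 fun hx' => hx (hts i hx')
      exact contDiffAt_const.congr_of_eventuallyEq h0
  have hcs : ∀ i, HasCompactSupport (h i) := fun i =>
    Metric.isCompact_of_isClosed_isBounded (isClosed_tsupport _)
      ((hb i).subset ((hts i).trans (hχ i)))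
  have hloc : ∀ i, ∫ x in Ω, fderiv ℝ (h i) x v =
      ∫ x in frontier Ω, h i x * ⟪v, outwardNormal Ω x⟫ ∂μHE[2] := fun i =>
    (hc i).integral_fderiv hΩ.isOpen (hcd i) (hcs i) ((hts i).trans (hχ i)) v
  have hfsum : ∀ x ∈ closure Ω, ∑ i, h i x = f x := fun x hx => by
    rw [← Finset.sum_mul, hsum x hx, one_mul]
  calc ∫ x in Ω, fderiv ℝ f x v = ∫ x in Ω, ∑ i, fderiv ℝ (h i) x v := by
        refine setIntegral_congr_fun hΩ.isOpen.measurableSet fun x hx => ?_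
        have hev : f =ᶠ[𝓝 x] fun y => ∑ i, h i y := by
          filter_upwards [hΩ.isOpen.mem_nhds hx] with y hy
          exact (hfsum y (subset_closure hy)).symm
        rw [hev.fderiv_eq, fderiv_fun_sum fun i _ =>
          (hcd i).differentiable one_ne_zero |>.differentiableAt]
        simp
    _ = ∑ i, ∫ x in Ω, fderiv ℝ (h i) x v := by
        refine integral_finsetSum _ fun i _ => ?_
        refine hΩ.integrableOn_of_continuousOn (Continuous.continuousOn ?_)
        exact ((hcd i).continuous_fderiv one_ne_zero).clm_apply continuous_const
    _ = ∑ i, ∫ x in frontier Ω, h i x * ⟪v, outwardNormal Ω x⟫ ∂μHE[2] :=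
        Finset.sum_congr rfl fun i _ => hloc i
    _ = ∫ x in frontier Ω, ∑ i, h i x * ⟪v, outwardNormal Ω x⟫ ∂μHE[2] :=
        (integral_finsetSum _ fun i _ =>
          hΩ.integrableOn_frontier_mul_inner (hcd i).continuous.continuousOn v).symm
    _ = ∫ x in frontier Ω, f x * ⟪v, outwardNormal Ω x⟫ ∂μHE[2] := by
        refine setIntegral_congr_fun isClosed_frontier.measurableSet fun x hx => ?_
        rw [← Finset.sum_mul, hfsum x (frontier_subset_closure hx)]

/-- The **divergence theorem** on a bounded Lipschitz domain. -/
theorem integral_divg (hΩ : IsBoundedLipschitzDomain Ω) {F : E3 → E3}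
    (hF : ∀ x ∈ closure Ω, ContDiffAt ℝ 1 F x) :
    ∫ x in Ω, divg F x = ∫ x in frontier Ω, ⟪F x, outwardNormal Ω x⟫ ∂μHE[2] := by
  have hFj : ∀ j : Fin 3, ∀ x ∈ closure Ω, ContDiffAt ℝ 1 (fun y => F y j) x :=
    fun j x hx => (contDiffAt_piLp 2).1 (hF x hx) j
  have hcont : ∀ j : Fin 3, ContinuousOn (fun x => pd j (fun y => F y j) x) (closure Ω) :=
    fun j x hx => by
      have h : ContinuousAt (fderiv ℝ fun y => F y j) x :=
        ((hFj j x hx).fderiv_right (m := 0) le_rfl).continuousAt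
      exact (h.clm_apply continuousAt_const).continuousWithinAt
  calc ∫ x in Ω, divg F x = ∑ j, ∫ x in Ω, pd j (fun y => F y j) x :=
        integral_finsetSum _ fun j _ => hΩ.integrableOn_of_continuousOn (hcont j)
    _ = ∑ j, ∫ x in frontier Ω, F x j * ⟪EuclideanSpace.single j 1, outwardNormal Ω x⟫ ∂μHE[2] :=
        Finset.sum_congr rfl fun j _ => hΩ.integral_fderiv (hFj j) _
    _ = ∫ x in frontier Ω, ∑ j, F x j * ⟪EuclideanSpace.single j 1, outwardNormal Ω x⟫ ∂μHE[2] :=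
        (integral_finsetSum _ fun j _ => hΩ.integrableOn_frontier_mul_inner
          (fun x hx => (hFj j x hx).continuousAt.continuousWithinAt) _).symm
    _ = ∫ x in frontier Ω, ⟪F x, outwardNormal Ω x⟫ ∂μHE[2] := by
        congr 1
        ext x
        rw [PiLp.inner_apply]
        refine Finset.sum_congr rfl fun j _ => ?_
        rw [EuclideanSpace.inner_single_left]
        simp [mul_comm]

end IsBoundedLipschitzDomain

/-! ### The local energy identity -/

theorem pd_add {f g : E3 → ℝ} {x : E3} (j : Fin 3) (hf : DifferentiableAt ℝ f x)
    (hg : DifferentiableAt ℝ g x) : pd j (fun y => f y + g y) x = pd j f x + pd j g x := by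
  simp [pd, fderiv_fun_add hf hg]

theorem pd_sub {f g : E3 → ℝ} {x : E3} (j : Fin 3) (hf : DifferentiableAt ℝ f x)
    (hg : DifferentiableAt ℝ g x) : pd j (fun y => f y - g y) x = pd j f x - pd j g x := by
  simp [pd, fderiv_fun_sub hf hg]

theorem pd_mul {f g : E3 → ℝ} {x : E3} (j : Fin 3) (hf : DifferentiableAt ℝ f x)
    (hg : DifferentiableAt ℝ g x) :
    pd j (fun y => f y * g y) x = f x * pd j g x + g x * pd j f x := by
  simp [pd, fderiv_fun_mul hf hg]

theorem pd_const_mul {f : E3 → ℝ} {x : E3} (j : Fin 3) (c : ℝ) (hf : DifferentiableAt ℝ f x) :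
    pd j (fun y => c * f y) x = c * pd j f x := by
  simp [pd, fderiv_const_mul hf]

theorem contDiffAt_pd {f : E3 → ℝ} {x : E3} {m n : WithTop ℕ∞} (j : Fin 3)
    (hf : ContDiffAt ℝ n f x) (hmn : m + 1 ≤ n) : ContDiffAt ℝ m (pd j f) x :=
  (hf.fderiv_right hmn).clm_apply contDiffAt_const

theorem contDiffAt_apply {F : E3 → E3} {x : E3} {n : WithTop ℕ∞} (hF : ContDiffAt ℝ n F x)
    (i : Fin 3) : ContDiffAt ℝ n (fun y => F y i) x :=
  (contDiffAt_piLp 2).1 hF i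

theorem contDiffAt_curl {F : E3 → E3} {x : E3} {m n : WithTop ℕ∞} (hF : ContDiffAt ℝ n F x)
    (hmn : m + 1 ≤ n) : ContDiffAt ℝ m (curl F) x := by
  refine (contDiffAt_piLp 2).2 fun i => ?_
  have h := fun i j => contDiffAt_pd j (contDiffAt_apply hF i) hmn
  fin_cases i
  · exact (h 2 1).sub (h 1 2)
  · exact (h 0 2).sub (h 2 0)
  · exact (h 1 0).sub (h 0 1)

theorem contDiffAt_current {ρ : E3 → ℝ} {B : E3 → E3} {x : E3} (hρ0 : ρ x ≠ 0)
    (hρ : ContDiffAt ℝ 1 ρ x) (hB : ContDiffAt ℝ 2 B x) : ContDiffAt ℝ 1 (current ρ B) x :=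
  (hρ.inv hρ0).smul (contDiffAt_curl hB (by norm_num [one_add_one_eq_two]))

theorem contDiffAt_cross {F G : E3 → E3} {x : E3} {n : WithTop ℕ∞} (hF : ContDiffAt ℝ n F x)
    (hG : ContDiffAt ℝ n G x) : ContDiffAt ℝ n (fun y => cross (F y) (G y)) x := by
  refine (contDiffAt_piLp 2).2 fun i => ?_
  have hf := contDiffAt_apply hF
  have hg := contDiffAt_apply hG
  fin_cases i
  · exact ((hf 1).mul (hg 2)).sub ((hf 2).mul (hg 1))
  · exact ((hf 2).mul (hg 0)).sub ((hf 0).mul (hg 2))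
  · exact ((hf 0).mul (hg 1)).sub ((hf 1).mul (hg 0))

/-- The flux of the magnetic energy. -/
def energyFlux (u : E3 → E3) (ρ : E3 → ℝ) (B : E3 → E3) (x : E3) : E3 :=
  ‖B x‖ ^ 2 • u x
    + (2 : ℝ) • (⟪current ρ B x, B x⟫ • B x - ‖B x‖ ^ 2 • current ρ B x)

theorem inner_eq (a b : E3) : ⟪a, b⟫ = a 0 * b 0 + a 1 * b 1 + a 2 * b 2 := by
  rw [PiLp.inner_apply, Fin.sum_univ_three]
  simp [mul_comm]

theorem norm_sq_eq (a : E3) : ‖a‖ ^ 2 = a 0 * a 0 + a 1 * a 1 + a 2 * a 2 := by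
  rw [← real_inner_self_eq_norm_sq, inner_eq]

theorem contDiffAt_energyFlux {u : E3 → E3} {ρ : E3 → ℝ} {B : E3 → E3} {x : E3}
    (hρ0 : ρ x ≠ 0) (hu : ContDiffAt ℝ 1 u x) (hρ : ContDiffAt ℝ 1 ρ x)
    (hB : ContDiffAt ℝ 2 B x) : ContDiffAt ℝ 1 (energyFlux u ρ B) x := by
  have hJ := contDiffAt_current hρ0 hρ hB
  have hB1 : ContDiffAt ℝ 1 B x := hB.of_le one_le_two
  have h1 : ContDiffAt ℝ 1
      (fun y => ⟪current ρ B y, B y⟫ • B y - ‖B y‖ ^ 2 • current ρ B y) x :=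
    ((hJ.inner ℝ hB1).smul hB1).sub ((hB1.norm_sq ℝ).smul hJ)
  have h2 : ContDiffAt ℝ 1 (fun y => ‖B y‖ ^ 2 • u y) x := (hB1.norm_sq ℝ).smul hu
  exact h2.add (h1.const_smul (2 : ℝ))

/-- The transport part rests on `div(|B|² u) = |B|² div u + 2B·(u·∇)B`. The Hall part rests on
`div(a × b) = b·∇×a - a·∇×b` with `a = J × B`, `b = B`, together with `(J × B)·(∇ × B) = 0`. Both
are checked in coordinates. -/
theorem two_mul_inner_splitRHS {u : E3 → E3} {ρ : E3 → ℝ} {B : E3 → E3} {x : E3}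
    (hρ0 : ρ x ≠ 0) (hu : ContDiffAt ℝ 1 u x) (hρ : ContDiffAt ℝ 1 ρ x)
    (hB : ContDiffAt ℝ 2 B x) :
    2 * ⟪B x, splitRHS u ρ B x⟫ =
      2 * ⟪B x, advect B u x⟫ - divg u x * ‖B x‖ ^ 2 - divg (energyFlux u ρ B) x := by
  have hJc := contDiffAt_current hρ0 hρ hB
  have hb : ∀ i, DifferentiableAt ℝ (fun y => B y i) x := fun i =>
    (contDiffAt_apply hB i).differentiableAt two_ne_zero
  have hv : ∀ i, DifferentiableAt ℝ (fun y => u y i) x := fun i =>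
    (contDiffAt_apply hu i).differentiableAt one_ne_zero
  have hJ : ∀ i, DifferentiableAt ℝ (fun y => current ρ B y i) x := fun i =>
    (contDiffAt_apply hJc i).differentiableAt one_ne_zero
  have hflux : ∀ j, (fun y => energyFlux u ρ B y j) = fun y =>
      (B y 0 * B y 0 + B y 1 * B y 1 + B y 2 * B y 2) * u y j +
        2 * ((current ρ B y 0 * B y 0 + current ρ B y 1 * B y 1 + current ρ B y 2 * B y 2) * B y j -
          (B y 0 * B y 0 + B y 1 * B y 1 + B y 2 * B y 2) * current ρ B y j) := by
    intro j
    ext y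
    simp [energyFlux, norm_sq_eq, inner_eq]
  have hpflux : ∀ j, pd j (fun y => energyFlux u ρ B y j) x =
      (B x 0 * B x 0 + B x 1 * B x 1 + B x 2 * B x 2) * pd j (fun y => u y j) x +
      u x j * (2 * ∑ i, B x i * pd j (fun y => B y i) x) +
      2 * ((∑ i, current ρ B x i * B x i) * pd j (fun y => B y j) x +
        B x j * (∑ i, (current ρ B x i * pd j (fun y => B y i) x +
          B x i * pd j (fun y => current ρ B y i) x)) -
        ((B x 0 * B x 0 + B x 1 * B x 1 + B x 2 * B x 2) * pd j (fun y => current ρ B y j) x +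
      current ρ B x j * (2 * ∑ i, B x i * pd j (fun y => B y i) x))) := by
    intro j
    have hbb : ∀ i, DifferentiableAt ℝ (fun y => B y i * B y i) x := fun i => (hb i).mul (hb i)
    have hJb : ∀ i, DifferentiableAt ℝ (fun y => current ρ B y i * B y i) x :=
      fun i => (hJ i).mul (hb i)
    have hbb3 := ((hbb 0).fun_add (hbb 1)).fun_add (hbb 2)
    have hJb3 := ((hJb 0).fun_add (hJb 1)).fun_add (hJb 2)
    have hX := hJb3.fun_mul (hb j)
    have hY := hbb3.fun_mul (hJ j)
    rw [hflux, pd_add j (hbb3.fun_mul (hv j)) ((hX.fun_sub hY).const_mul 2),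
      pd_const_mul j 2 (hX.fun_sub hY), pd_sub j hX hY, pd_mul j hbb3 (hv j), pd_mul j hJb3 (hb j),
      pd_mul j hbb3 (hJ j), pd_add j ((hbb 0).fun_add (hbb 1)) (hbb 2), pd_add j (hbb 0) (hbb 1),
      pd_add j ((hJb 0).fun_add (hJb 1)) (hJb 2), pd_add j (hJb 0) (hJb 1)]
    simp only [pd_mul j (hb _) (hb _), pd_mul j (hJ _) (hb _), Fin.sum_univ_three]
    ring
  have hdivT : ∀ i j, pd j (fun y => B y i * u y j) x =
      B x i * pd j (fun y => u y j) x + u x j * pd j (fun y => B y i) x :=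
    fun i j => pd_mul j (hb i) (hv j)
  have hcr : ∀ j i k, pd j (fun y => current ρ B y i * B y k - current ρ B y k * B y i) x =
      (current ρ B x i * pd j (fun y => B y k) x + B x k * pd j (fun y => current ρ B y i) x) -
      (current ρ B x k * pd j (fun y => B y i) x + B x i * pd j (fun y => current ρ B y k) x) :=
    fun j i k => by
      rw [pd_sub j ((hJ i).fun_mul (hb k)) ((hJ k).fun_mul (hb i)), pd_mul j (hJ i) (hb k),
        pd_mul j (hJ k) (hb i)]
  have hc0 : ∀ y, cross (current ρ B y) (B y) 0 =
      current ρ B y 1 * B y 2 - current ρ B y 2 * B y 1 := fun y => by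
    simp [cross, crossProduct]
  have hc1 : ∀ y, cross (current ρ B y) (B y) 1 =
      current ρ B y 2 * B y 0 - current ρ B y 0 * B y 2 := fun y => by
    simp [cross, crossProduct]
  have hc2 : ∀ y, cross (current ρ B y) (B y) 2 =
      current ρ B y 0 * B y 1 - current ρ B y 1 * B y 0 := fun y => by
    simp [cross, crossProduct]
  have hJ0 : current ρ B x 0 = (ρ x)⁻¹ * (pd 1 (fun y => B y 2) x - pd 2 (fun y => B y 1) x) := rfl
  have hJ1 : current ρ B x 1 = (ρ x)⁻¹ * (pd 2 (fun y => B y 0) x - pd 0 (fun y => B y 2) x) := rfl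
  have hJ2 : current ρ B x 2 = (ρ x)⁻¹ * (pd 0 (fun y => B y 1) x - pd 1 (fun y => B y 0) x) := rfl
  have hR : ∀ i, splitRHS u ρ B x i = advect B u x i -
      1 / 2 * (divg u x * B x i + advect u B x i + divTensor B u x i) -
      curl (fun y => cross (current ρ B y) (B y)) x i := fun i => by
    simp [splitRHS]
    ring
  rw [inner_eq, inner_eq, norm_sq_eq, hR, hR, hR]
  simp only [divg, hpflux, advect, divTensor, hdivT, Fin.sum_univ_three]
  simp only [curl, hc0, hc1, hc2, hcr, Matrix.cons_val_zero, Matrix.cons_val_one, Matrix.cons_val]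
  -- Only the values of the current are expanded, so that `(J × B)·(∇ × B)` cancels; its derivatives
  -- stay as unknowns and no second derivative of `B` appears.
  rw [hJ0, hJ1, hJ2]
  ring

/-- Each of the nine terms `2BᵢBⱼ∂ⱼuᵢ` is at most `M(Bᵢ² + Bⱼ²)`, for a total of `6M|B|²`; the
divergence contributes another `3M|B|²`. -/
theorem two_mul_inner_advect_sub_le {u B : E3 → E3} {x : E3} {M : ℝ}
    (hM : ∀ i j, |pd j (fun y => u y i) x| ≤ M) :
    2 * ⟪B x, advect B u x⟫ - divg u x * ‖B x‖ ^ 2 ≤ 9 * M * ‖B x‖ ^ 2 := by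
  have h1 : ∀ i j, 2 * (B x i * (B x j * pd j (fun y => u y i) x)) ≤
      M * (B x i * B x i + B x j * B x j) := fun i j => by
    obtain ⟨h1, h2⟩ := abs_le.1 (hM i j)
    nlinarith [mul_nonneg (sub_nonneg.2 h2) (sq_nonneg (B x i + B x j)),
      mul_nonneg (neg_le_iff_add_nonneg.1 h1) (sq_nonneg (B x i - B x j))]
  have h2 : -divg u x ≤ 3 * M := by
    rw [divg, Fin.sum_univ_three]
    linarith [(abs_le.1 (hM 0 0)).1, (abs_le.1 (hM 1 1)).1, (abs_le.1 (hM 2 2)).1]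
  have h3 := mul_le_mul_of_nonneg_right h2 (sq_nonneg ‖B x‖)
  have h4 : 2 * ⟪B x, advect B u x⟫ ≤ 6 * M * ‖B x‖ ^ 2 := by
    rw [inner_eq, norm_sq_eq]
    simp only [advect, Fin.sum_univ_three]
    linarith [h1 0 0, h1 0 1, h1 0 2, h1 1 0, h1 1 1, h1 1 2, h1 2 0, h1 2 1, h1 2 2]
  linarith

/-- With `w = u/2 - J`, both sides contain `2(B·ν)(J·B)`. They differ by `2|B|² max(w·ν, 0)`: the
outflow condition controls precisely the inflow part of `w·ν`. -/
theorem two_mul_inner_outflow_le (Ω : Set E3) (u : E3 → E3) (ρ : E3 → ℝ) (B : E3 → E3) (x : E3) :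
    2 * ⟪B x, outflow Ω u ρ B x⟫ ≤ ⟪energyFlux u ρ B x, outwardNormal Ω x⟫ := by
  have hflux : ⟪energyFlux u ρ B x, outwardNormal Ω x⟫ =
      2 * ‖B x‖ ^ 2 * ⟪(1 / 2 : ℝ) • u x - current ρ B x, outwardNormal Ω x⟫ +
        2 * (⟪current ρ B x, B x⟫ * ⟪B x, outwardNormal Ω x⟫) := by
    simp only [energyFlux, inner_add_left, inner_sub_left, real_inner_smul_left]
    ring
  rw [hflux, outflow, inner_add_right, real_inner_smul_right, real_inner_comm (B x)]
  split_ifs with h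
  · rw [real_inner_smul_right, real_inner_self_eq_norm_sq]
    apply le_of_eq
    ring
  · rw [inner_zero_right]
    nlinarith [mul_nonneg (sq_nonneg ‖B x‖) (not_lt.1 h)]

/-! ### Continuity up to the boundary -/

theorem continuousAt_pd {f : E3 → ℝ} {x : E3} (j : Fin 3) (hf : ContDiffAt ℝ 1 f x) :
    ContinuousAt (pd j f) x :=
  (contDiffAt_pd (m := 0) j hf (by simp)).continuousAt

theorem continuousAt_toLp {F : E3 → Fin 3 → ℝ} {x : E3}
    (h : ∀ i, ContinuousAt (fun y => F y i) x) :
    ContinuousAt (fun y => (WithLp.toLp 2 (F y) : E3)) x :=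
  (PiLp.continuous_toLp 2 _).continuousAt.comp (continuousAt_pi.2 h)

theorem continuousAt_advect {a F : E3 → E3} {x : E3} (ha : ContinuousAt a x)
    (hF : ContDiffAt ℝ 1 F x) : ContinuousAt (advect a F) x :=
  continuousAt_toLp fun i => tendsto_finsetSum _ fun j _ =>
    (((EuclideanSpace.proj j : E3 →L[ℝ] ℝ).continuous.continuousAt.comp ha).mul
      (continuousAt_pd j (contDiffAt_apply hF i)))

theorem continuousAt_divg {F : E3 → E3} {x : E3} (hF : ContDiffAt ℝ 1 F x) :
    ContinuousAt (divg F) x :=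
  tendsto_finsetSum _ fun j _ => continuousAt_pd j (contDiffAt_apply hF j)

theorem continuousAt_divTensor {F a : E3 → E3} {x : E3} (hF : ContDiffAt ℝ 1 F x)
    (ha : ContDiffAt ℝ 1 a x) : ContinuousAt (divTensor F a) x :=
  continuousAt_toLp fun i => tendsto_finsetSum _ fun j _ =>
    continuousAt_pd j ((contDiffAt_apply hF i).mul (contDiffAt_apply ha j))

theorem continuousAt_splitRHS {u : E3 → E3} {ρ : E3 → ℝ} {B : E3 → E3} {x : E3}
    (hρ0 : ρ x ≠ 0) (hu : ContDiffAt ℝ 1 u x) (hρ : ContDiffAt ℝ 1 ρ x)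
    (hB : ContDiffAt ℝ 2 B x) : ContinuousAt (splitRHS u ρ B) x := by
  have hB1 : ContDiffAt ℝ 1 B x := hB.of_le one_le_two
  have hJ := contDiffAt_current hρ0 hρ hB
  have h1 := continuousAt_advect hB.continuousAt hu
  have h2 : ContinuousAt (fun y => divg u y • B y) x :=
    (continuousAt_divg hu).smul hB.continuousAt
  have h3 := continuousAt_advect hu.continuousAt hB1
  have h4 := continuousAt_divTensor hB1 hu
  have h5 : ContinuousAt (curl fun y => cross (current ρ B y) (B y)) x :=
    (contDiffAt_curl (m := 0) (contDiffAt_cross hJ hB1) (by simp)).continuousAt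
  exact (h1.sub (((h2.add h3).add h4).const_smul (1 / 2 : ℝ))).sub h5

/-! ### Integrability -/

theorem integrableOn_inner {K S : Set E3} {μ : Measure E3} {G H : E3 → E3} (hK : IsCompact K)
    (hSK : S ⊆ K) (hS : MeasurableSet S) (hG : ContinuousOn G K) (hH : IntegrableOn H S μ) :
    IntegrableOn (fun x => ⟪G x, H x⟫) S μ := by
  obtain ⟨C, hC⟩ := hK.exists_bound_of_continuousOn hG
  refine Integrable.mono' (hH.norm.const_mul C)
    (((hG.mono hSK).aestronglyMeasurable hS).inner hH.aestronglyMeasurable) ?_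
  refine (ae_restrict_iff' hS).2 (.of_forall fun x hx => ?_)
  exact (norm_inner_le_norm _ _).trans
    (mul_le_mul_of_nonneg_right (hC x (hSK hx)) (norm_nonneg _))

/-- Writing the indicator as a minimum makes measurability and the pointwise bound immediate. -/
theorem outflow_eq (Ω : Set E3) (u : E3 → E3) (ρ : E3 → ℝ) (B : E3 → E3) (x : E3) :
    outflow Ω u ρ B x =
      min ⟪(1 / 2 : ℝ) • u x - current ρ B x, outwardNormal Ω x⟫ 0 • B x
        + ⟪B x, outwardNormal Ω x⟫ • current ρ B x := by
  rw [outflow]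
  split_ifs with h
  · rw [min_eq_left h.le]
  · rw [min_eq_right (not_lt.1 h), zero_smul]

namespace IsBoundedLipschitzDomain

variable {Ω : Set E3}

theorem integrableOn_outwardNormal (hΩ : IsBoundedLipschitzDomain Ω) :
    IntegrableOn (outwardNormal Ω) (frontier Ω) μHE[2] := by
  have := hΩ.isFiniteMeasure_frontier
  exact Integrable.of_bound hΩ.aestronglyMeasurable_outwardNormal 1
    (.of_forall (norm_outwardNormal_le Ω))

theorem integrableOn_outflow (hΩ : IsBoundedLipschitzDomain Ω) {u : E3 → E3} {ρ : E3 → ℝ}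
    {B : E3 → E3} (hu : ContinuousOn u (closure Ω)) (hB : ContinuousOn B (closure Ω))
    (hJ : ContinuousOn (current ρ B) (closure Ω)) :
    IntegrableOn (outflow Ω u ρ B) (frontier Ω) μHE[2] := by
  have := hΩ.isFiniteMeasure_frontier
  have hw : ContinuousOn (fun x => (1 / 2 : ℝ) • u x - current ρ B x) (closure Ω) :=
    (hu.const_smul (1 / 2 : ℝ)).sub hJ
  obtain ⟨C, hC⟩ := hΩ.isCompact_closure.exists_bound_of_continuousOn
    (f := fun x => ‖(1 / 2 : ℝ) • u x - current ρ B x‖ * ‖B x‖ + ‖B x‖ * ‖current ρ B x‖)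
    ((hw.norm.mul hB.norm).add (hB.norm.mul hJ.norm))
  have hν := hΩ.aestronglyMeasurable_outwardNormal
  have hin : ∀ {w : E3 → E3}, ContinuousOn w (closure Ω) →
      AEStronglyMeasurable (fun x => ⟪w x, outwardNormal Ω x⟫) (μHE[2].restrict (frontier Ω)) :=
    fun hw => (aestronglyMeasurable_frontier hw).inner hν
  have hmin := (hin hw).inf (aestronglyMeasurable_const (b := (0 : ℝ)))
  have hm := (hmin.smul (aestronglyMeasurable_frontier hB)).add
    ((hin hB).smul (aestronglyMeasurable_frontier hJ))
  refine Integrable.of_bound (C := C) (hm.congr (.of_forall fun x => ?_)) ?_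
  · exact (outflow_eq Ω u ρ B x).symm
  · refine (ae_restrict_iff' isClosed_frontier.measurableSet).2 (.of_forall fun x hx => ?_)
    refine le_trans ?_ ((Real.le_norm_self _).trans (hC x (frontier_subset_closure hx)))
    rw [outflow_eq]
    have hin : ∀ w : E3, |⟪w, outwardNormal Ω x⟫| ≤ ‖w‖ := fun w =>
      (abs_real_inner_le_norm _ _).trans
        (mul_le_of_le_one_right (norm_nonneg _) (norm_outwardNormal_le Ω x))
    refine (norm_add_le _ _).trans (add_le_add ?_ ?_)
    · rw [norm_smul]
      refine mul_le_mul_of_nonneg_right ?_ (norm_nonneg _)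
      refine le_trans ?_ (hin _)
      rw [Real.norm_eq_abs]
      rcases le_total ⟪(1 / 2 : ℝ) • u x - current ρ B x, outwardNormal Ω x⟫ 0 with h | h
      · rw [min_eq_left h]
      · rw [min_eq_right h, abs_zero]
        exact abs_nonneg _
    · rw [norm_smul]
      exact mul_le_mul_of_nonneg_right (hin _) (norm_nonneg _)

end IsBoundedLipschitzDomain

/-! ### Testing with continuous fields -/

/-- Tietze extends the field from the compact set to the whole space, where smooth maps are dense
for uniform convergence on compacts. -/
theorem exists_smooth_approx {K : Set E3} (hK : IsCompact K) {φ : E3 → E3}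
    (hφ : ContinuousOn φ K) {ε : ℝ} (hε : 0 < ε) :
    ∃ θ : E3 → E3, ContDiff ℝ ∞ θ ∧ ∀ x ∈ K, ‖θ x - φ x‖ < ε := by
  have : TietzeExtension E3 := TietzeExtension.of_tvs ℝ
  obtain ⟨f, hf⟩ := ContinuousMap.exists_restrict_eq hK.isClosed ⟨K.domRestrict φ, hφ.domRestrict⟩
  obtain ⟨θ, hθ, hθf⟩ := (mem_closure_iff_nhds_basis
    (nhds_basis_uniformity Metric.uniformity_basis_dist.compactConvergenceUniformity)).1
    (ContinuousMap.dense_setOfPred_contDiff f) (K, ε) ⟨hK, hε⟩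
  refine ⟨θ, hθ, fun x hx => ?_⟩
  have h1 : dist (θ x) (f x) < ε := hθf x hx
  have h2 : f x = φ x := DFunLike.congr_fun hf ⟨x, hx⟩
  rwa [← dist_eq_norm, ← h2]

theorem tendsto_integral_inner {K S : Set E3} {μ : Measure E3} {θ : ℕ → E3 → E3} {φ H : E3 → E3}
    (hK : IsCompact K) (hSK : S ⊆ K) (hS : MeasurableSet S) (hφ : ContinuousOn φ K)
    (hθ : ∀ n, Continuous (θ n)) (hθφ : ∀ n : ℕ, ∀ x ∈ K, ‖θ n x - φ x‖ < 1 / ((n : ℝ) + 1))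
    (hH : IntegrableOn H S μ) :
    Filter.Tendsto (fun n => ∫ x in S, ⟪θ n x, H x⟫ ∂μ) Filter.atTop
      (𝓝 (∫ x in S, ⟪φ x, H x⟫ ∂μ)) := by
  obtain ⟨C, hC⟩ := hK.exists_bound_of_continuousOn hφ
  refine tendsto_integral_of_dominated_convergence (fun x => (1 + C) * ‖H x‖)
    (fun n => (hθ n).aestronglyMeasurable.inner hH.aestronglyMeasurable) (hH.norm.const_mul _)
    (fun n => (ae_restrict_iff' hS).2 (.of_forall fun x hx => ?_))
    ((ae_restrict_iff' hS).2 (.of_forall fun x hx => ?_))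
  · refine (norm_inner_le_norm _ _).trans (mul_le_mul_of_nonneg_right ?_ (norm_nonneg _))
    have h1 : 1 / ((n : ℝ) + 1) ≤ 1 := by
      rw [div_le_one (by positivity)]
      linarith [(Nat.cast_nonneg n : (0 : ℝ) ≤ n)]
    have h2 := norm_le_norm_sub_add (θ n x) (φ x)
    linarith [hC x (hSK hx), hθφ n x (hSK hx)]
  · refine Filter.Tendsto.inner ?_ tendsto_const_nhds
    rw [tendsto_iff_norm_sub_tendsto_zero]
    exact squeeze_zero (fun n => norm_nonneg _) (fun n => (hθφ n x (hSK hx)).le)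
      tendsto_one_div_add_atTop_nhds_zero_nat

/-- An identity of functionals on smooth fields extends to continuous fields. -/
theorem IsBoundedLipschitzDomain.integral_inner_eq_of_forall_smooth {Ω : Set E3}
    (hΩ : IsBoundedLipschitzDomain Ω) {D R ψ φ : E3 → E3} (hD : IntegrableOn D Ω)
    (hR : IntegrableOn R Ω) (hψ : IntegrableOn ψ (frontier Ω) μHE[2])
    (h : ∀ φ : E3 → E3, ContDiff ℝ ∞ φ →
      (∫ x in Ω, ⟪φ x, D x⟫) = (∫ x in Ω, ⟪φ x, R x⟫) + lifting Ω ψ φ)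
    (hφ : ContinuousOn φ (closure Ω)) :
    (∫ x in Ω, ⟪φ x, D x⟫) = (∫ x in Ω, ⟪φ x, R x⟫) + lifting Ω ψ φ := by
  choose θ hθ hθφ using fun n : ℕ => exists_smooth_approx hΩ.isCompact_closure hφ
    (Nat.one_div_pos_of_nat (α := ℝ) (n := n))
  have hθc := fun n => (hθ n).continuous
  have hm := hΩ.isOpen.measurableSet
  have h1 := tendsto_integral_inner hΩ.isCompact_closure subset_closure hm hφ hθc hθφ hD
  have h2 := tendsto_integral_inner hΩ.isCompact_closure subset_closure hm hφ hθc hθφ hR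
  have h3 := tendsto_integral_inner hΩ.isCompact_closure frontier_subset_closure
    isClosed_frontier.measurableSet hφ hθc hθφ hψ
  exact tendsto_nhds_unique h1 ((h2.add h3).congr fun n => (h (θ n) (hθ n)).symm)

/-! ### The time derivative of the energy -/

/-- Expressing the time derivative through the joint derivative is what gives its continuity in `(t,
x)`. -/
theorem hasDerivAt_dt {B : ℝ → E3 → E3} {t : ℝ} {x : E3}
    (h : ContDiffAt ℝ 1 (fun p : ℝ × E3 => B p.1 p.2) (t, x)) :
    HasDerivAt (fun s => B s x) (dt B t x) t ∧
      dt B t x = fderiv ℝ (fun p : ℝ × E3 => B p.1 p.2) (t, x) (1, 0) := by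
  have h1 : HasDerivAt (fun s : ℝ => (s, x)) (1, 0) t :=
    (hasDerivAt_id t).prodMk (hasDerivAt_const t x)
  have h2 := (h.differentiableAt one_ne_zero).hasFDerivAt.comp_hasDerivAt t h1
  exact ⟨h2.differentiableAt.hasDerivAt, h2.deriv⟩

theorem continuousOn_dt {B : ℝ → E3 → E3} {S : Set (ℝ × E3)}
    (h : ∀ p ∈ S, ContDiffAt ℝ 1 (fun p : ℝ × E3 => B p.1 p.2) p) :
    ContinuousOn (fun p : ℝ × E3 => dt B p.1 p.2) S := by
  have h1 : ContinuousOn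
      (fun p : ℝ × E3 => fderiv ℝ (fun p : ℝ × E3 => B p.1 p.2) p (1, 0)) S := fun p hp =>
    ((((h p hp).fderiv_right (m := 0) le_rfl).continuousAt).clm_apply
      continuousAt_const).continuousWithinAt
  exact h1.congr fun p hp => (hasDerivAt_dt (h p hp)).2

/-- Near `t`, the time derivative of `|B|²` is bounded by its maximum on a compact time interval
times `closure Ω`, a constant integrable over the bounded set `Ω`. -/
theorem hasDerivAt_l2NormSq {T : ℝ} {Ω : Set E3} (hΩ : IsBoundedLipschitzDomain Ω)
    {B : ℝ → E3 → E3}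
    (hB : ∀ t ∈ Ioo 0 T, ∀ x ∈ closure Ω, ContDiffAt ℝ 1 (fun p : ℝ × E3 => B p.1 p.2) (t, x))
    {t : ℝ} (ht : t ∈ Ioo 0 T) :
    HasDerivAt (fun s => l2NormSq Ω (B s)) (2 * (∫ x in Ω, ⟪B t x, dt B t x⟫)) t := by
  obtain ⟨ε, hε, hεT⟩ := Metric.nhds_basis_closedBall.mem_iff.1 (isOpen_Ioo.mem_nhds ht)
  set S : Set (ℝ × E3) := Metric.closedBall t ε ×ˢ closure Ω with hS
  have hSc : IsCompact S := (isCompact_closedBall t ε).prod hΩ.isCompact_closure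
  have hBS : ∀ p ∈ S, ContDiffAt ℝ 1 (fun p : ℝ × E3 => B p.1 p.2) p := fun p hp =>
    hB p.1 (hεT hp.1) p.2 hp.2
  have hBc : ContinuousOn (fun p : ℝ × E3 => B p.1 p.2) S := fun p hp =>
    (hBS p hp).continuousAt.continuousWithinAt
  have hDc : ContinuousOn (fun p : ℝ × E3 => 2 * ⟪B p.1 p.2, dt B p.1 p.2⟫) S :=
    continuousOn_const.mul (hBc.inner (continuousOn_dt hBS))
  obtain ⟨C, hC⟩ := hSc.exists_bound_of_continuousOn hDc
  have hslice : ∀ s ∈ Metric.closedBall t ε, MapsTo (fun x : E3 => (s, x)) (closure Ω) S :=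
    fun s hs x hx => ⟨hs, hx⟩
  have hpair : ∀ s : ℝ, ContinuousOn (fun x : E3 => (s, x)) (closure Ω) := fun s => by fun_prop
  have hint : ∀ s ∈ Metric.closedBall t ε, IntegrableOn (fun x => ‖B s x‖ ^ 2) Ω := fun s hs =>
    hΩ.integrableOn_of_continuousOn ((hBc.comp (hpair s) (hslice s hs)).norm.pow 2)
  have htε : t ∈ Metric.closedBall t ε := Metric.mem_closedBall_self hε.le
  have hm := hΩ.isOpen.measurableSet
  have key := hasDerivAt_integral_of_dominated_loc_of_deriv_le (μ := volume.restrict Ω)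
    (F := fun s x => ‖B s x‖ ^ 2) (F' := fun s x => 2 * ⟪B s x, dt B s x⟫) (x₀ := t)
    (bound := fun _ => C) (Metric.ball_mem_nhds t hε)
    (Filter.eventually_of_mem (Metric.closedBall_mem_nhds t hε)
      fun s hs => (hint s hs).aestronglyMeasurable)
    (hint t htε)
    (hΩ.integrableOn_of_continuousOn
      (hDc.comp (hpair t) (hslice t htε))).aestronglyMeasurable
    ((ae_restrict_iff' hm).2 (.of_forall fun x hx s hs =>
      hC (s, x) ⟨Metric.ball_subset_closedBall hs, subset_closure hx⟩))
    (hΩ.integrableOn_of_continuousOn continuousOn_const)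
    ((ae_restrict_iff' hm).2 (.of_forall fun x hx s hs =>
      (hasDerivAt_dt (hBS (s, x)
        ⟨Metric.ball_subset_closedBall hs, subset_closure hx⟩)).1.norm_sq))
  have h2 := key.2
  rw [integral_const_mul] at h2
  exact h2

/-! ### The energy inequality -/

theorem abs_pd_le_gradSupNorm {Ω : Set E3} (hΩ : IsBoundedLipschitzDomain Ω) {u : E3 → E3}
    (hu : ∀ x ∈ closure Ω, ContDiffAt ℝ 1 u x) :
    ∀ᵐ x ∂(volume.restrict Ω), ∀ i j, |pd j (fun y => u y i) x| ≤ gradSupNorm Ω u := by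
  refine ae_all_iff.2 fun i => ae_all_iff.2 fun j => ?_
  have hc : ContinuousOn (fun x => pd j (fun y => u y i) x) (closure Ω) := fun x hx =>
    (continuousAt_pd j (contDiffAt_apply (hu x hx) i)).continuousWithinAt
  obtain ⟨C, hC⟩ := hΩ.isCompact_closure.exists_bound_of_continuousOn hc
  -- Finiteness matters because `toReal` would send an infinite norm to `0`.
  have hfin : eLpNorm (fun x => pd j (fun y => u y i) x) ⊤ (volume.restrict Ω) ≠ ⊤ := by
    refine (memLp_top_of_bound (hΩ.integrableOn_of_continuousOn hc).aestronglyMeasurable C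
      ((ae_restrict_iff' hΩ.isOpen.measurableSet).2
        (.of_forall fun x hx => hC x (subset_closure hx)))).eLpNorm_ne_top
  have hle : (eLpNorm (fun x => pd j (fun y => u y i) x) ⊤ (volume.restrict Ω)).toReal ≤
      gradSupNorm Ω u :=
    le_ciSup (f := fun p : Fin 3 × Fin 3 =>
      (eLpNorm (fun x => pd p.2 (fun y => u y p.1) x) ⊤ (volume.restrict Ω)).toReal)
      (finite_range _).bddAbove (i, j)
  filter_upwards [ae_le_eLpNormEssSup (f := fun x => pd j (fun y => u y i) x)
    (μ := volume.restrict Ω)] with x hx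
  rw [← eLpNorm_exponent_top] at hx
  refine le_trans ?_ hle
  have := ENNReal.toReal_mono hfin hx
  rwa [toReal_enorm, Real.norm_eq_abs] at this

/-- The energy inequality, for fields at a fixed time, `D` being the time derivative. -/
theorem two_mul_integral_inner_le {Ω : Set E3} (hΩ : IsBoundedLipschitzDomain Ω) {u : E3 → E3}
    {ρ : E3 → ℝ} {B D : E3 → E3} (hρ0 : ∀ x ∈ closure Ω, ρ x ≠ 0)
    (hu : ∀ x ∈ closure Ω, ContDiffAt ℝ 1 u x) (hρ : ∀ x ∈ closure Ω, ContDiffAt ℝ 1 ρ x)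
    (hB : ∀ x ∈ closure Ω, ContDiffAt ℝ 2 B x)
    (h : (∫ x in Ω, ⟪B x, D x⟫) =
      (∫ x in Ω, ⟪B x, splitRHS u ρ B x⟫) + lifting Ω (outflow Ω u ρ B) B) :
    2 * (∫ x in Ω, ⟪B x, D x⟫) ≤ 9 * gradSupNorm Ω u * l2NormSq Ω B := by
  have hK := hΩ.isCompact_closure
  have hm := hΩ.isOpen.measurableSet
  have hBc : ContinuousOn B (closure Ω) := fun x hx => (hB x hx).continuousAt.continuousWithinAt
  have huc : ContinuousOn u (closure Ω) := fun x hx => (hu x hx).continuousAt.continuousWithinAt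
  have hJc : ContinuousOn (current ρ B) (closure Ω) := fun x hx =>
    (contDiffAt_current (hρ0 x hx) (hρ x hx) (hB x hx)).continuousAt.continuousWithinAt
  have hG : ∀ x ∈ closure Ω, ContDiffAt ℝ 1 (energyFlux u ρ B) x := fun x hx =>
    contDiffAt_energyFlux (hρ0 x hx) (hu x hx) (hρ x hx) (hB x hx)
  have hGc : ContinuousOn (energyFlux u ρ B) (closure Ω) := fun x hx =>
    (hG x hx).continuousAt.continuousWithinAt
  have hVc : ContinuousOn (fun x => 2 * ⟪B x, advect B u x⟫ - divg u x * ‖B x‖ ^ 2)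
      (closure Ω) := fun x hx =>
    ((continuousAt_const.mul ((hB x hx).continuousAt.inner
      (continuousAt_advect (hB x hx).continuousAt (hu x hx)))).sub
        ((continuousAt_divg (hu x hx)).mul
          ((hB x hx).continuousAt.norm.pow 2))).continuousWithinAt
  have hV := hΩ.integrableOn_of_continuousOn hVc
  have hdiv : IntegrableOn (divg (energyFlux u ρ B)) Ω := hΩ.integrableOn_of_continuousOn
    fun x hx => (continuousAt_divg (hG x hx)).continuousWithinAt
  have hvol : 2 * (∫ x in Ω, ⟪B x, splitRHS u ρ B x⟫) =
      (∫ x in Ω, (2 * ⟪B x, advect B u x⟫ - divg u x * ‖B x‖ ^ 2)) -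
        ∫ x in frontier Ω, ⟪energyFlux u ρ B x, outwardNormal Ω x⟫ ∂μHE[2] := by
    rw [← hΩ.integral_divg hG, ← integral_sub hV hdiv, ← integral_const_mul]
    refine setIntegral_congr_fun hm fun x hx => ?_
    have hx' := subset_closure hx
    exact two_mul_inner_splitRHS (hρ0 x hx') (hu x hx') (hρ x hx') (hB x hx')
  have hbdry : 2 * lifting Ω (outflow Ω u ρ B) B ≤
      ∫ x in frontier Ω, ⟪energyFlux u ρ B x, outwardNormal Ω x⟫ ∂μHE[2] := by
    rw [lifting, surfaceIntegral, ← integral_const_mul]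
    refine integral_mono ?_ ?_ fun x => two_mul_inner_outflow_le Ω u ρ B x
    · exact (integrableOn_inner hK frontier_subset_closure isClosed_frontier.measurableSet hBc
        (hΩ.integrableOn_outflow huc hBc hJc)).const_mul 2
    · exact integrableOn_inner hK frontier_subset_closure isClosed_frontier.measurableSet hGc
        hΩ.integrableOn_outwardNormal
  have hbound : (∫ x in Ω, (2 * ⟪B x, advect B u x⟫ - divg u x * ‖B x‖ ^ 2)) ≤
      9 * gradSupNorm Ω u * l2NormSq Ω B := by
    rw [l2NormSq, ← integral_const_mul]
    refine integral_mono_ae hV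
      ((hΩ.integrableOn_of_continuousOn (hBc.norm.pow 2)).const_mul _) ?_
    filter_upwards [abs_pd_le_gradSupNorm hΩ hu] with x hx
    exact two_mul_inner_advect_sub_le hx
  -- The energy flux through the boundary cancels between `hvol` and `hbdry`.
  linarith

end HallInduction

end

/-! ### The strong and weak implementations -/

theorem mainTheorem1 (T : ℝ) (Ω : Set HallInduction.E3)
    (hΩ : HallInduction.IsBoundedLipschitzDomain Ω)
    (u : ℝ → HallInduction.E3 → HallInduction.E3) (ρ : ℝ → HallInduction.E3 → ℝ)
    (B : ℝ → HallInduction.E3 → HallInduction.E3)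
    (hρ : ∀ t ∈ Ioo 0 T, ∀ x ∈ closure Ω, ρ t x ≠ 0)
    (hsmooth : HallInduction.SufficientlySmooth T Ω u ρ B)
    (hsol : HallInduction.IsStrongOutflowSolution T Ω u ρ B ∨
      HallInduction.IsWeakOutflowSolution T Ω u ρ B) :
    ∀ t ∈ Ioo 0 T,
      HasDerivAt (fun s => HallInduction.l2NormSq Ω (B s))
        (2 * (∫ x in Ω, ⟪B t x, HallInduction.dt B t x⟫)) t ∧
      2 * (∫ x in Ω, ⟪B t x, HallInduction.dt B t x⟫) ≤
        9 * HallInduction.gradSupNorm Ω (u t) * HallInduction.l2NormSq Ω (B t) := by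
  intro t ht
  have hB := hsmooth.field_space t ht
  have hu := hsmooth.velocity t ht
  have hd := hsmooth.density t ht
  refine ⟨HallInduction.hasDerivAt_l2NormSq hΩ hsmooth.field_joint ht,
    HallInduction.two_mul_integral_inner_le hΩ (hρ t ht) hu hd hB ?_⟩
  rcases hsol with h | h
  · obtain ⟨h1, h2⟩ := h t ht
    -- A strong solution satisfies the tested identity with `φ = B` trivially, since its boundary
    -- term vanishes.
    have hzero : HallInduction.lifting Ω (HallInduction.outflow Ω (u t) (ρ t) (B t)) (B t) = 0 := by
      refine setIntegral_eq_zero_of_forall_eq_zero fun x hx => ?_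
      rw [h2 x hx, inner_zero_right]
    rw [hzero, add_zero]
    refine setIntegral_congr_fun hΩ.isOpen.measurableSet fun x hx => ?_
    simp only [h1 x hx]
  · have hdt : ContinuousOn (HallInduction.dt B t) (closure Ω) :=
      (HallInduction.continuousOn_dt (S := {t} ×ˢ closure Ω) (by
        rintro ⟨s, x⟩ ⟨rfl, hx⟩
        exact hsmooth.field_joint _ ht x hx)).comp
          (by fun_prop : ContinuousOn (fun x : HallInduction.E3 => (t, x)) (closure Ω))
          fun x hx => ⟨rfl, hx⟩
    -- `B t` is only `C²` near `closure Ω`, so using it as a test field requires the extension of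
    -- the weak identity to continuous fields.
    refine hΩ.integral_inner_eq_of_forall_smooth (hΩ.integrableOn_of_continuousOn hdt)
      (hΩ.integrableOn_of_continuousOn fun x hx => ?_)
      (hΩ.integrableOn_outflow (fun x hx => ?_) (fun x hx => ?_) fun x hx => ?_)
      (h t ht) fun x hx => ?_
    · exact (HallInduction.continuousAt_splitRHS (hρ t ht x hx) (hu x hx) (hd x hx)
        (hB x hx)).continuousWithinAt
    · exact (hu x hx).continuousAt.continuousWithinAt
    · exact (hB x hx).continuousAt.continuousWithinAt
    · exact (HallInduction.contDiffAt_current (hρ t ht x hx) (hd x hx)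
        (hB x hx)).continuousAt.continuousWithinAt
    · exact (hB x hx).continuousAt.continuousWithinAt
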